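/- Let $(M,g)$ be a Riemannian manifold. For a smooth function $\phi=u+iv:M\to\mathbb C$ let $\nabla\phi=\nabla u+i\nabla v$ be its gradient, a section of the complexified tangent bundle, let $\tau(\phi)=\operatorname{div}(\nabla\phi)$ be the complex linear Laplace--Beltrami operator, and let $\kappa(\phi,\phi)=g(\nabla\phi,\nabla\phi)$, where $g$ is extended complex bilinearly. The function $\phi$ is called an eigenfunction if there are $\lambda,\mu\in\mathbb C$ with $\tau(\phi)=\lambda\phi$ and $\kappa(\phi,\phi)=\mu\phi^2$ on $M$. Let $n\ge 1$ be an integer, and let $\mathbb CP^{2n-1}$ carry its Fubini--Study metric, normalised so that the Hopf map from the unit sphere $S^{4n-1}\subset\mathbb C^{2n}$ is a Riemannian submersion. Put $\Sigma_n=\{a\in\mathbb C^n : a_k\neq 0 \text{ for } k=1,\dots,n\}$, and for $a\in\mathbb C^n$ define $$\Phi_a:\mathbb CP^{2n-1}\to\mathbb C,\qquad \Phi_a([z_1,\dots,z_{2n}])=\frac{1}{|z|^2}\sum_{k=1}^n a_k\, z_k\,\bar z_{n+k}.$$ Then for every $a\in\Sigma_n$: 1. $\Phi_a$ is a (smooth)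 eigenfunction on $\mathbb CP^{2n-1}$; 2. the fibre $\Phi_a^{-1}(\{0\})$ is non-empty, and $\nabla\Phi_a(p)\neq 0$ at each of its points $p$; 3. $\Phi_a^{-1}(\{0\})$ is a minimal submanifold (an embedded submanifold with vanishing mean curvature vector) of $\mathbb CP^{2n-1}$ of real codimension two. Hence $\{\Phi_a^{-1}(\{0\}) : a\in\Sigma_n\}$ is a family of minimal submanifolds of codimension two depending on $n$ complex parameters: $\Sigma_n$ is a non-empty open subset of $\mathbb C^n$, $\Phi_a(p)$ depends smoothly on $(a,p)\in\mathbb C^n\times\mathbb CP^{2n-1}$ and holomorphically on $a$, and for $a,b\in\Sigma_n$ one has $\Phi_a^{-1}(\{0\})=\Phi_b^{-1}(\{0\})$ if and only if $b=c\,a$ for some $c\in\mathbb C$. -/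

import Mathlib

open scoped Manifold ContDiff LinearAlgebra.Projectivization

noncomputable section

/-- The complex projective space `ℂP^m`. -/
abbrev CProj (m : ℕ) : Type := ℙ ℂ (EuclideanSpace ℂ (Fin (m + 1)))

namespace CProj

/-- The non-zero vectors of `ℂ^{m+1}`. -/
abbrev NZ (m : ℕ) : Type := {z : EuclideanSpace ℂ (Fin (m + 1)) // z ≠ 0}

/-- The quotient topology. -/
instance instTopologicalSpace (m : ℕ) : TopologicalSpace (CProj m) :=
  TopologicalSpace.coinduced (fun z : NZ m => Projectivization.mk ℂ z.1 z.2) inferInstance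

variable {m : ℕ}

theorem isQuotientMap_mk :
    Topology.IsQuotientMap (fun z : NZ m => Projectivization.mk ℂ z.1 z.2) :=
  ⟨⟨rfl⟩, fun p => by
    induction p with
    | h v hv => exact ⟨⟨v, hv⟩, rfl⟩⟩

/-- The lift `(w_1, …, 1, …, w_m)` to `ℂ^{m+1}` (with `1` at place `k`) of the point with affine
coordinates `w`. -/
def lift (k : Fin (m + 1)) (w : EuclideanSpace ℂ (Fin m)) : EuclideanSpace ℂ (Fin (m + 1)) :=
  WithLp.toLp 2 (Fin.insertNth (α := fun _ => ℂ) k 1 w)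

/-- The derivative `(v_1, …, 0, …, v_m)` (with `0` at place `k`) of `lift k` in the direction
`v`. -/
def liftDir (k : Fin (m + 1)) (v : EuclideanSpace ℂ (Fin m)) : EuclideanSpace ℂ (Fin (m + 1)) :=
  WithLp.toLp 2 (Fin.insertNth (α := fun _ => ℂ) k 0 v)

@[simp] theorem lift_same (k : Fin (m + 1)) (w : EuclideanSpace ℂ (Fin m)) : lift k w k = 1 := by
  simp [lift]

@[simp] theorem lift_succAbove (k : Fin (m + 1)) (w : EuclideanSpace ℂ (Fin m)) (j : Fin m) :
    lift k w (k.succAbove j) = w j := by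
  simp [lift]

@[simp] theorem liftDir_same (k : Fin (m + 1)) (w : EuclideanSpace ℂ (Fin m)) :
    liftDir k w k = 0 := by
  simp [liftDir]

@[simp] theorem liftDir_succAbove (k : Fin (m + 1)) (w : EuclideanSpace ℂ (Fin m)) (j : Fin m) :
    liftDir k w (k.succAbove j) = w j := by
  simp [liftDir]

theorem lift_ne_zero (k : Fin (m + 1)) (w : EuclideanSpace ℂ (Fin m)) : lift k w ≠ 0 := fun h => by
  have := congrArg (fun z : EuclideanSpace ℂ (Fin (m + 1)) => z k) h
  simp at this

/-- The affine coordinates `(z_j / z_k)_{j ≠ k}`. -/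
def affineCoord (k : Fin (m + 1)) (z : EuclideanSpace ℂ (Fin (m + 1))) :
    EuclideanSpace ℂ (Fin m) :=
  WithLp.toLp 2 fun j => z (k.succAbove j) / z k

theorem affineCoord_smul (k : Fin (m + 1)) (z : EuclideanSpace ℂ (Fin (m + 1))) {t : ℂ}
    (ht : t ≠ 0) : affineCoord k (t • z) = affineCoord k z := by
  ext j
  simp [affineCoord, mul_div_mul_left _ _ ht]

theorem smul_lift_affineCoord (k : Fin (m + 1)) {z : EuclideanSpace ℂ (Fin (m + 1))}
    (hz : z k ≠ 0) : z k • lift k (affineCoord k z) = z := by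
  ext i
  rcases Fin.eq_self_or_eq_succAbove k i with rfl | ⟨j, rfl⟩
  · simp
  · simp [affineCoord, mul_div_cancel₀ _ hz]

@[simp] theorem affineCoord_lift (k : Fin (m + 1)) (w : EuclideanSpace ℂ (Fin m)) :
    affineCoord k (lift k w) = w := by
  ext j
  simp [affineCoord]

/-- The set of points `[z]` with `z_k ≠ 0`. -/
def affineDomain (k : Fin (m + 1)) : Set (CProj m) :=
  {p | Projectivization.lift (fun z : NZ m => z.1 k ≠ 0) (by
    rintro ⟨a, ha⟩ ⟨b, hb⟩ t (rfl : a = t • b)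
    have ht : t ≠ 0 := fun h => ha (by simp [h])
    simp [ht]) p}

theorem mem_affineDomain (k : Fin (m + 1)) {z : EuclideanSpace ℂ (Fin (m + 1))}
    (hz : z ≠ 0) : Projectivization.mk ℂ z hz ∈ affineDomain k ↔ z k ≠ 0 := Iff.rfl

theorem isOpen_affineDomain (k : Fin (m + 1)) : IsOpen (affineDomain (m := m) k) := by
  rw [← isQuotientMap_mk.isOpen_preimage]
  show IsOpen {z : NZ m | z.1 k ≠ 0}
  exact isOpen_ne_fun (by fun_prop) continuous_const

/-- The affine chart `[z] ↦ (z_j / z_k)_{j ≠ k}` of `ℂP^m`, defined where `z_k ≠ 0`. -/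
def affineChart (k : Fin (m + 1)) :
    OpenPartialHomeomorph (CProj m) (EuclideanSpace ℂ (Fin m)) where
  toFun := Projectivization.lift (fun z : NZ m => affineCoord k z.1) (by
    rintro ⟨a, ha⟩ ⟨b, hb⟩ t (rfl : a = t • b)
    exact affineCoord_smul k b (fun h => ha (by simp [h])))
  invFun w := Projectivization.mk ℂ (lift k w) (lift_ne_zero k w)
  source := affineDomain k
  target := Set.univ
  map_source' _ _ := trivial
  map_target' w _ := by simp [mem_affineDomain]
  left_inv' p hp := by
    induction p using Projectivization.ind with
    | h z hz =>
      have hp' : z k ≠ 0 := hp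
      rw [Projectivization.lift_mk, Projectivization.mk_eq_mk_iff']
      refine ⟨(z k)⁻¹, ?_⟩
      conv_lhs => rw [← smul_lift_affineCoord k hp']
      simp [smul_smul, inv_mul_cancel₀ hp']
  right_inv' w _ := by simp
  open_source := isOpen_affineDomain k
  open_target := isOpen_univ
  continuousOn_toFun := by
    rw [isQuotientMap_mk.continuousOn_isOpen_iff (isOpen_affineDomain k)]
    show ContinuousOn (fun z : NZ m => WithLp.toLp 2 fun j => z.1 (k.succAbove j) / z.1 k)
      {z | z.1 k ≠ 0}
    refine (PiLp.continuous_toLp 2 _).comp_continuousOn (continuousOn_pi.2 fun j => ?_)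
    exact ContinuousOn.div (by fun_prop) (by fun_prop) fun z hz => hz
  continuousOn_invFun := by
    refine Continuous.continuousOn ?_
    have : Continuous fun w : EuclideanSpace ℂ (Fin m) =>
        (⟨lift k w, lift_ne_zero k w⟩ : NZ m) := by
      refine Continuous.subtype_mk ((PiLp.continuous_toLp 2 _).comp (continuous_pi fun i => ?_)) _
      rcases Fin.eq_self_or_eq_succAbove k i with rfl | ⟨j, rfl⟩
      · simpa using continuous_const
      · simp only [Fin.insertNth_apply_succAbove]
        fun_prop
    exact isQuotientMap_mk.continuous.comp this

theorem mem_affineChart_source (k : Fin (m + 1)) {z : EuclideanSpace ℂ (Fin (m + 1))}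
    (hz : z ≠ 0) : Projectivization.mk ℂ z hz ∈ (affineChart k).source ↔ z k ≠ 0 := Iff.rfl

theorem affineChart_mk (k : Fin (m + 1)) {z : EuclideanSpace ℂ (Fin (m + 1))} (hz : z ≠ 0) :
    affineChart k (Projectivization.mk ℂ z hz) = affineCoord k z := rfl

theorem affineChart_symm (k : Fin (m + 1)) (w : EuclideanSpace ℂ (Fin m)) :
    (affineChart k).symm w = Projectivization.mk ℂ (lift k w) (lift_ne_zero k w) := rfl

theorem exists_mem_affineChart_source (p : CProj m) : ∃ k, p ∈ (affineChart k).source := by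
  induction p using Projectivization.ind with
  | h z hz =>
    by_contra! h
    exact hz (by ext k; simpa [mem_affineChart_source] using h k)

/-- The index of an affine chart around `p`. -/
def chartIndex (p : CProj m) : Fin (m + 1) := Classical.choose (exists_mem_affineChart_source p)

instance instChartedSpace (m : ℕ) : ChartedSpace (EuclideanSpace ℂ (Fin m)) (CProj m) where
  atlas := Set.range affineChart
  chartAt p := affineChart (chartIndex p)
  mem_chart_source p := Classical.choose_spec (exists_mem_affineChart_source p)
  chart_mem_atlas _ := ⟨_, rfl⟩

theorem chartAt_eq (p : CProj m) :
    chartAt (EuclideanSpace ℂ (Fin m)) p = affineChart (chartIndex p) := rfl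

theorem contDiff_lift (k i : Fin (m + 1)) :
    ContDiff ℝ ω fun w : EuclideanSpace ℂ (Fin m) => lift k w i := by
  rcases Fin.eq_self_or_eq_succAbove k i with rfl | ⟨j, rfl⟩
  · simpa using contDiff_const
  · simp only [lift_succAbove]
    fun_prop

/-- The coordinate change from the `k`-th to the `l`-th affine chart. -/
theorem contDiffOn_transition (k l : Fin (m + 1)) :
    ContDiffOn ℝ ω (fun w => affineCoord l (lift k w)) {w | lift k w l ≠ 0} := by
  refine contDiffOn_piLp' _ fun j => ?_
  show ContDiffOn ℝ ω (fun w => lift k w (l.succAbove j) / lift k w l) _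
  simp only [div_eq_mul_inv]
  exact (contDiff_lift k _).contDiffOn.mul ((contDiff_lift k l).contDiffOn.inv fun w hw => hw)

instance instIsManifold (m : ℕ) : IsManifold 𝓘(ℝ, EuclideanSpace ℂ (Fin m)) ∞ (CProj m) := by
  refine isManifold_of_contDiffOn _ _ _ ?_
  rintro _ _ ⟨k, rfl⟩ ⟨l, rfl⟩
  refine ((contDiffOn_transition k l).of_le (by simp)).mono ?_
  intro w hw
  exact hw.1.2


/-- The component of `a ∈ ℂ^{m+1}` which is Hermitian-orthogonal to `z`. -/
def horizontal (z a : EuclideanSpace ℂ (Fin (m + 1))) : EuclideanSpace ℂ (Fin (m + 1)) :=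
  a - (inner ℂ z a / inner ℂ z z) • z

theorem horizontal_smul_add {z : EuclideanSpace ℂ (Fin (m + 1))} (hz : z ≠ 0) {c : ℂ} (hc : c ≠ 0)
    (b : ℂ) (a : EuclideanSpace ℂ (Fin (m + 1))) :
    horizontal (c • z) (c • a + b • z) = c • horizontal z a := by
  have h1 : inner ℂ z z ≠ 0 := inner_self_ne_zero.2 hz
  have h2 : (starRingEnd ℂ) c ≠ 0 := by simpa using hc
  simp only [horizontal, inner_add_right, inner_smul_left, inner_smul_right, smul_sub, smul_smul]
  rw [add_sub_assoc, sub_eq_add_neg (c • a), add_right_inj, ← sub_smul, ← neg_smul]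
  congr 1
  field_simp
  ring

theorem horizontal_add (z a b : EuclideanSpace ℂ (Fin (m + 1))) :
    horizontal z (a + b) = horizontal z a + horizontal z b := by
  simp only [horizontal, inner_add_right, add_div, add_smul]
  abel

theorem horizontal_smul (z a : EuclideanSpace ℂ (Fin (m + 1))) (c : ℂ) :
    horizontal z (c • a) = c • horizontal z a := by
  simp only [horizontal, inner_smul_right, smul_sub, smul_smul, mul_div_assoc]

/-- The scalar product of the images under `dπ_z` of `a` and `b`, where `π : ℂ^{m+1} ∖ 0 → ℂP^m` is
the projection: for `|z| = 1` this is the Euclidean scalar product of the horizontal parts of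
`a` and `b`, so that the Hopf map from the unit sphere is a Riemannian submersion. -/
def hopfForm (z a b : EuclideanSpace ℂ (Fin (m + 1))) : ℝ :=
  (inner ℂ (horizontal z a) (horizontal z b)).re / ‖z‖ ^ 2

theorem hopfForm_smul_add {z : EuclideanSpace ℂ (Fin (m + 1))} (hz : z ≠ 0) {c : ℂ} (hc : c ≠ 0)
    (α β : ℂ) (a b : EuclideanSpace ℂ (Fin (m + 1))) :
    hopfForm (c • z) (c • a + α • z) (c • b + β • z) = hopfForm z a b := by
  have h : ‖c‖ ≠ 0 := norm_ne_zero_iff.2 hc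
  rw [hopfForm, hopfForm, horizontal_smul_add hz hc, horizontal_smul_add hz hc, inner_smul_left,
    inner_smul_right, ← mul_assoc, ← Complex.normSq_eq_conj_mul_self, Complex.re_ofReal_mul,
    norm_smul, mul_pow, Complex.normSq_eq_norm_sq, mul_div_mul_left _ _ (pow_ne_zero 2 h)]

theorem liftDir_add (k : Fin (m + 1)) (v w : EuclideanSpace ℂ (Fin m)) :
    liftDir k (v + w) = liftDir k v + liftDir k w := by
  ext i
  rcases Fin.eq_self_or_eq_succAbove k i with rfl | ⟨j, rfl⟩ <;> simp

theorem liftDir_smul (k : Fin (m + 1)) (c : ℂ) (v : EuclideanSpace ℂ (Fin m)) :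
    liftDir k (c • v) = c • liftDir k v := by
  ext i
  rcases Fin.eq_self_or_eq_succAbove k i with rfl | ⟨j, rfl⟩ <;> simp

/-- The Fubini–Study metric at the point `w` of the `k`-th affine chart. -/
def fsLocal (k : Fin (m + 1)) (w : EuclideanSpace ℂ (Fin m)) :
    EuclideanSpace ℂ (Fin m) →L[ℝ] EuclideanSpace ℂ (Fin m) →L[ℝ] ℝ :=
  LinearMap.toContinuousBilinearMap <| LinearMap.mk₂ ℝ
    (fun v u => hopfForm (lift k w) (liftDir k v) (liftDir k u))
    (fun v v' u => by
      simp only [hopfForm, liftDir_add, horizontal_add, inner_add_left, Complex.add_re, add_div])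
    (fun c v u => by
      rw [← Complex.coe_smul c v]
      simp only [hopfForm, liftDir_smul, horizontal_smul, inner_smul_left, Complex.conj_ofReal,
        Complex.re_ofReal_mul, mul_div_assoc, smul_eq_mul])
    (fun v u u' => by
      simp only [hopfForm, liftDir_add, horizontal_add, inner_add_right, Complex.add_re, add_div])
    (fun c v u => by
      rw [← Complex.coe_smul c u]
      simp only [hopfForm, liftDir_smul, horizontal_smul, inner_smul_right,
        Complex.re_ofReal_mul, mul_div_assoc, smul_eq_mul])

theorem fsLocal_apply (k : Fin (m + 1)) (w v u : EuclideanSpace ℂ (Fin m)) :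
    fsLocal k w v u = hopfForm (lift k w) (liftDir k v) (liftDir k u) := rfl

theorem fsLocal_symm (k : Fin (m + 1)) (w v u : EuclideanSpace ℂ (Fin m)) :
    fsLocal k w v u = fsLocal k w u v := by
  rw [fsLocal_apply, fsLocal_apply, hopfForm, hopfForm, ← inner_conj_symm, Complex.conj_re]

theorem norm_lift_sq (k : Fin (m + 1)) (w : EuclideanSpace ℂ (Fin m)) :
    ‖lift k w‖ ^ 2 = 1 + ‖w‖ ^ 2 := by
  rw [EuclideanSpace.norm_sq_eq, EuclideanSpace.norm_sq_eq, Fin.sum_univ_succAbove _ k]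
  simp

theorem norm_liftDir_sq (k : Fin (m + 1)) (v : EuclideanSpace ℂ (Fin m)) :
    ‖liftDir k v‖ ^ 2 = ‖v‖ ^ 2 := by
  rw [EuclideanSpace.norm_sq_eq, EuclideanSpace.norm_sq_eq, Fin.sum_univ_succAbove _ k]
  simp

theorem inner_lift_liftDir (k : Fin (m + 1)) (w v : EuclideanSpace ℂ (Fin m)) :
    inner ℂ (lift k w) (liftDir k v) = inner ℂ w v := by
  rw [PiLp.inner_apply, PiLp.inner_apply, Fin.sum_univ_succAbove _ k]
  simp

theorem norm_horizontal_sq {z : EuclideanSpace ℂ (Fin (m + 1))} (hz : z ≠ 0)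
    (a : EuclideanSpace ℂ (Fin (m + 1))) :
    (inner ℂ (horizontal z a) (horizontal z a)).re = ‖a‖ ^ 2 - ‖inner ℂ z a‖ ^ 2 / ‖z‖ ^ 2 := by
  have h1 : ‖z‖ ≠ 0 := norm_ne_zero_iff.2 hz
  have h2 : inner ℂ z (horizontal z a) = 0 := by
    rw [horizontal, inner_sub_right, inner_smul_right, div_mul_cancel₀ _ (inner_self_ne_zero.2 hz),
      sub_self]
  have h3 : a = horizontal z a + (inner ℂ z a / inner ℂ z z) • z := by simp [horizontal]
  have h4 := norm_add_sq (𝕜 := ℂ) (horizontal z a) ((inner ℂ z a / inner ℂ z z) • z)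
  rw [← h3, inner_smul_right, inner_eq_zero_symm.1 h2, mul_zero, map_zero, norm_smul, norm_div,
    inner_self_eq_norm_sq_to_K] at h4
  have h5 : (inner ℂ (horizontal z a) (horizontal z a)).re = ‖horizontal z a‖ ^ 2 :=
    inner_self_eq_norm_sq (𝕜 := ℂ) _
  rw [h5, h4]
  simp
  field_simp
  ring

/-- Lower bound for the metric, which gives positivity. -/
theorem le_fsLocal (k : Fin (m + 1)) (w v : EuclideanSpace ℂ (Fin m)) :
    ‖v‖ ^ 2 / (‖lift k w‖ ^ 2) ^ 2 ≤ fsLocal k w v v := by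
  have hz := lift_ne_zero k w
  have hpos : 0 < ‖lift k w‖ ^ 2 := by positivity
  rw [fsLocal_apply, hopfForm, norm_horizontal_sq hz, norm_liftDir_sq, inner_lift_liftDir,
    div_le_div_iff₀ (by positivity) hpos]
  have h := norm_inner_le_norm (𝕜 := ℂ) w v
  have h' : ‖inner ℂ w v‖ ^ 2 ≤ ‖w‖ ^ 2 * ‖v‖ ^ 2 := by
    rw [← mul_pow]
    gcongr
  have h2 := norm_lift_sq k w
  set N := ‖lift k w‖ ^ 2
  have h3 : (‖v‖ ^ 2 - ‖inner ℂ w v‖ ^ 2 / N) * N ^ 2 = (‖v‖ ^ 2 * N - ‖inner ℂ w v‖ ^ 2) * N := by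
    field_simp
  rw [h3]
  gcongr
  rw [h2]
  linarith

theorem contDiff_fsLocal_apply (k : Fin (m + 1)) (v u : EuclideanSpace ℂ (Fin m)) :
    ContDiff ℝ ω fun w => fsLocal k w v u := by
  have hl : ContDiff ℝ ω fun w : EuclideanSpace ℂ (Fin m) => lift k w :=
    contDiff_piLp' _ fun i => contDiff_lift k i
  have hh : ∀ a : EuclideanSpace ℂ (Fin (m + 1)),
      ContDiff ℝ ω fun w : EuclideanSpace ℂ (Fin m) => horizontal (lift k w) a := fun a => by
    refine contDiff_const.sub (ContDiff.smul (f := fun w =>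
      inner ℂ (lift k w) a / inner ℂ (lift k w) (lift k w)) ?_ hl)
    simp only [div_eq_mul_inv]
    exact (hl.inner ℂ contDiff_const).mul
      ((hl.inner ℂ hl).inv fun w => inner_self_ne_zero.2 (lift_ne_zero k w))
  exact (Complex.reCLM.contDiff.comp ((hh _).inner ℂ (hh _))).div (hl.norm_sq ℂ)
    fun w => pow_ne_zero 2 (norm_ne_zero_iff.2 (lift_ne_zero k w))

theorem contDiff_fsLocal (k : Fin (m + 1)) :
    ContDiff ℝ ω fun w : EuclideanSpace ℂ (Fin m) => fsLocal k w := by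
  simp only [contDiff_clm_apply_iff]
  exact fun v u => contDiff_fsLocal_apply k v u

/-- The local expressions of the metric agree under coordinate changes. -/
theorem fsLocal_transition (k l : Fin (m + 1)) {w : EuclideanSpace ℂ (Fin m)}
    (hw : lift k w l ≠ 0) {D : EuclideanSpace ℂ (Fin m) →L[ℝ] EuclideanSpace ℂ (Fin m)}
    (hD : HasFDerivAt (fun w => affineCoord l (lift k w)) D w) (v u : EuclideanSpace ℂ (Fin m)) :
    fsLocal l (affineCoord l (lift k w)) (D v) (D u) = fsLocal k w v u := by
  have hline : ∀ (i : Fin (m + 1)) (v : EuclideanSpace ℂ (Fin m)) (t : ℝ),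
      lift k (w + t • v) i = lift k w i + t * liftDir k v i := fun i v t => by
    rcases Fin.eq_self_or_eq_succAbove k i with rfl | ⟨j, rfl⟩ <;> simp
  have key : ∀ v, liftDir l (D v) = (lift k w l)⁻¹ • liftDir k v +
      (-(lift k w l)⁻¹ ^ 2 * liftDir k v l) • lift k w := fun v => by
    ext i
    rcases Fin.eq_self_or_eq_succAbove l i with rfl | ⟨j, rfl⟩
    · simp
      field_simp
      simp
    · have hc : HasDerivAt (fun t : ℝ => w + t • v) v 0 := by
        simpa using ((hasDerivAt_id (0 : ℝ)).smul_const v).const_add w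
      have h1 : HasDerivAt (fun t : ℝ => affineCoord l (lift k (w + t • v))) (D v) 0 := by
        have hD' : HasFDerivAt (fun w => affineCoord l (lift k w)) D (w + (0 : ℝ) • v) := by
          simpa using hD
        exact hD'.comp_hasDerivAt (0 : ℝ) hc
      have h2 : HasDerivAt (fun t : ℝ => (lift k w (l.succAbove j) + t * liftDir k v (l.succAbove j)) /
          (lift k w l + t * liftDir k v l)) (D v j) 0 := by
        have := ((EuclideanSpace.proj j : EuclideanSpace ℂ (Fin m) →L[ℂ] ℂ).restrictScalars
          ℝ).hasFDerivAt.comp_hasDerivAt (0 : ℝ) h1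
        refine this.congr_of_eventuallyEq (Filter.Eventually.of_forall fun t => ?_)
        simp [affineCoord, hline]
      have h3 : ∀ i, HasDerivAt (fun t : ℝ => lift k w i + t * liftDir k v i) (liftDir k v i) 0 :=
        fun i => by
          simpa using ((Complex.ofRealCLM.hasDerivAt (x := (0 : ℝ))).mul_const
            (liftDir k v i)).const_add (lift k w i)
      have h4 := h2.unique ((h3 (l.succAbove j)).div (h3 l) (by simpa using hw))
      simp only [liftDir_succAbove, h4, PiLp.add_apply, PiLp.smul_apply, smul_eq_mul,
        Complex.ofReal_zero, zero_mul, add_zero]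
      field_simp
      ring
  have h0 : lift l (affineCoord l (lift k w)) = (lift k w l)⁻¹ • lift k w := by
    conv_rhs => rw [← smul_lift_affineCoord l hw]
    simp [smul_smul, hw]
  rw [fsLocal_apply, fsLocal_apply, h0, key, key]
  exact hopfForm_smul_add (lift_ne_zero k w) (inv_ne_zero hw) _ _ _ _

/-- The Fubini–Study scalar product on the tangent space at `p`. -/
def fsInner (p : CProj m) : TangentSpace 𝓘(ℝ, EuclideanSpace ℂ (Fin m)) p →L[ℝ]
    TangentSpace 𝓘(ℝ, EuclideanSpace ℂ (Fin m)) p →L[ℝ] ℝ :=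
  fsLocal (chartIndex p) (chartAt (EuclideanSpace ℂ (Fin m)) p p)

theorem contMDiff_fsInner (m : ℕ) :
    ContMDiff 𝓘(ℝ, EuclideanSpace ℂ (Fin m)) (𝓘(ℝ, EuclideanSpace ℂ (Fin m)).prod
      𝓘(ℝ, EuclideanSpace ℂ (Fin m) →L[ℝ] EuclideanSpace ℂ (Fin m) →L[ℝ] ℝ)) ∞
      (fun p : CProj m => Bundle.TotalSpace.mk'
        (EuclideanSpace ℂ (Fin m) →L[ℝ] EuclideanSpace ℂ (Fin m) →L[ℝ] ℝ)
        (E := fun p : CProj m => TangentSpace 𝓘(ℝ, EuclideanSpace ℂ (Fin m)) p →L[ℝ]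
          TangentSpace 𝓘(ℝ, EuclideanSpace ℂ (Fin m)) p →L[ℝ] ℝ) p (fsInner p)) := by
  intro p₀
  rw [Bundle.contMDiffAt_section]
  have h1 : ContMDiffAt 𝓘(ℝ, EuclideanSpace ℂ (Fin m))
      𝓘(ℝ, EuclideanSpace ℂ (Fin m) →L[ℝ] EuclideanSpace ℂ (Fin m) →L[ℝ] ℝ) ∞
      (fun p : CProj m => fsLocal (chartIndex p₀) (chartAt (EuclideanSpace ℂ (Fin m)) p₀ p)) p₀ :=
    ((contDiff_fsLocal (chartIndex p₀)).of_le (by simp)).contMDiff.contMDiffAt.comp p₀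
      (contMDiffAt_extChartAt (I := 𝓘(ℝ, EuclideanSpace ℂ (Fin m))))
  refine h1.congr_of_eventuallyEq ?_
  filter_upwards [(chartAt (EuclideanSpace ℂ (Fin m)) p₀).open_source.mem_nhds
    (mem_chart_source _ p₀)] with p hp
  rw [hom_trivializationAt_apply]
  ext v u
  rw [inCoordinates_apply_eq₂ (by simpa using hp) (by simpa using hp) (by simp)]
  have hsymm : ∀ v, (trivializationAt (EuclideanSpace ℂ (Fin m))
      (TangentSpace 𝓘(ℝ, EuclideanSpace ℂ (Fin m))) p₀).symm p v =
      (tangentBundleCore 𝓘(ℝ, EuclideanSpace ℂ (Fin m)) (CProj m)).coordChange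
        (achart _ p₀) (achart _ p) p v := fun v => by
    refine (Bundle.Trivialization.symmL_apply (R := ℝ) _ (by simpa using hp) v).symm.trans ?_
    exact congrArg (fun L : EuclideanSpace ℂ (Fin m) →L[ℝ] EuclideanSpace ℂ (Fin m) => L v)
      (TangentBundle.symmL_trivializationAt_eq_core hp)
  have hD := hasFDerivWithinAt_tangentCoordChange (I := 𝓘(ℝ, EuclideanSpace ℂ (Fin m)))
    (x := p₀) (y := p) (z := p) (by
      rw [extChartAt_source, extChartAt_source]
      exact ⟨hp, mem_chart_source _ p⟩)
  rw [modelWithCornersSelf_coe, Set.range_id, hasFDerivWithinAt_univ] at hD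
  obtain ⟨hw, hp'⟩ : lift (chartIndex p₀) (affineChart (chartIndex p₀) p) (chartIndex p) ≠ 0 ∧
      affineCoord (chartIndex p) (lift (chartIndex p₀) (affineChart (chartIndex p₀) p)) =
      affineChart (chartIndex p) p := by
    have h2 : p ∈ (affineChart (chartIndex p)).source := mem_chart_source _ p
    have h := (affineChart (chartIndex p₀)).left_inv hp
    generalize chartIndex p = l at h2
    generalize affineChart (chartIndex p₀) p = w at h
    rw [← h] at h2 ⊢
    exact ⟨h2, rfl⟩
  rw [hsymm, hsymm]
  have := fsLocal_transition (chartIndex p₀) (chartIndex p) hw hD v u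
  rw [hp'] at this
  rw [chartAt_eq, ← this]
  simp only [Bundle.Trivial.linearMapAt_trivialization, Bundle.Trivial.fiberBundle_trivializationAt']
  rfl

/-- The Fubini–Study metric of `ℂP^m`, normalised so that the Hopf map from the unit sphere is a
Riemannian submersion. -/
def fubiniStudy (m : ℕ) :
    Bundle.ContMDiffRiemannianMetric 𝓘(ℝ, EuclideanSpace ℂ (Fin m)) ∞ (EuclideanSpace ℂ (Fin m))
      (fun p : CProj m => TangentSpace 𝓘(ℝ, EuclideanSpace ℂ (Fin m)) p) where
  inner := fsInner
  symm p v w := fsLocal_symm _ _ _ _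
  pos p v hv := by
    have hv' : 0 < @norm (EuclideanSpace ℂ (Fin m)) _ v := norm_pos_iff.2 hv
    refine lt_of_lt_of_le ?_ (le_fsLocal _ _ _)
    have := norm_pos_iff.2 (lift_ne_zero (chartIndex p) (chartAt (EuclideanSpace ℂ (Fin m)) p p))
    positivity
  isVonNBounded p := by
    set N := ‖lift (chartIndex p) (chartAt (EuclideanSpace ℂ (Fin m)) p p)‖ with hN
    have hpos : 0 < N := norm_pos_iff.2 (lift_ne_zero _ _)
    have : Bornology.IsVonNBounded ℝ {v : EuclideanSpace ℂ (Fin m) |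
        fsLocal (chartIndex p) (chartAt (EuclideanSpace ℂ (Fin m)) p p) v v < 1} := by
      refine (NormedSpace.isVonNBounded_closedBall ℝ (EuclideanSpace ℂ (Fin m)) (N ^ 2)).subset
        fun v hv => ?_
      have h := (le_fsLocal _ _ _).trans_lt hv
      rw [← hN, div_lt_one (by positivity)] at h
      rw [mem_closedBall_zero_iff]
      exact (abs_le_of_sq_le_sq' h.le (by positivity)).2
    exact this
  contMDiff := contMDiff_fsInner m

end CProj

namespace RiemannianGeometry

variable {E : Type*} [NormedAddCommGroup E] [NormedSpace ℝ E] [FiniteDimensional ℝ E]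
  {M : Type*} [TopologicalSpace M] [ChartedSpace E M] [IsManifold 𝓘(ℝ, E) ∞ M]
  (g : Bundle.ContMDiffRiemannianMetric 𝓘(ℝ, E) ∞ E (fun p : M => TangentSpace 𝓘(ℝ, E) p))

/-- The metric coefficients in the preferred chart at `p`, at the point `x` of the chart:
`(v, w) ↦ ∑ g_ij(x) v_i w_j`. -/
def metricInChart (p : M) (x : E) : E →L[ℝ] E →L[ℝ] ℝ :=
  ContinuousLinearMap.bilinearComp (E := E) (F := E) (g.inner ((chartAt E p).symm x))
    (mfderiv 𝓘(ℝ, E) 𝓘(ℝ, E) (chartAt E p).symm x) (mfderiv 𝓘(ℝ, E) 𝓘(ℝ, E) (chartAt E p).symm x)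

/-- The Christoffel symbols of the Levi-Civita connection in the preferred chart at `p`:
`christoffel g p x w v` is the vector `Γ_x(v, w)` determined by
`2 g(Γ(v, w), u) = (D_v g)(w, u) + (D_w g)(v, u) - (D_u g)(v, w)` for all `u`. It is symmetric in
`v` and `w`, and `∇_v X = D_v X + Γ(v, X)`.
The form `metricInChart g p x` is positive definite, hence invertible, on the chart. -/
def christoffel (p : M) (x : E) (w : E) : E →L[ℝ] E :=
  (metricInChart g p x).inverse ∘L ((1 / 2 : ℝ) •
    (fderiv ℝ (metricInChart g p) x w + (fderiv ℝ (metricInChart g p) x).flip w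
      - ((fderiv ℝ (metricInChart g p) x).flip w).flip))

/-- The gradient of a real function: `g(∇u, v) = du(v)` for all tangent vectors `v`. -/
def gradient (u : M → ℝ) (p : M) : TangentSpace 𝓘(ℝ, E) p :=
  (g.inner p).inverse (mfderiv 𝓘(ℝ, E) 𝓘(ℝ, ℝ) u p)

/-- The components of the vector field `X` in the preferred chart at `p`. -/
def vectorFieldInChart (p : M) (X : ∀ q : M, TangentSpace 𝓘(ℝ, E) q) (x : E) : E :=
  mfderiv 𝓘(ℝ, E) 𝓘(ℝ, E) (chartAt E p) ((chartAt E p).symm x) (X ((chartAt E p).symm x))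

/-- The divergence of a vector field: the trace of `v ↦ ∇_v X`. -/
def divergence (X : ∀ q : M, TangentSpace 𝓘(ℝ, E) q) (p : M) : ℝ :=
  LinearMap.trace ℝ E (fderiv ℝ (vectorFieldInChart p X) (chartAt E p p)
    + christoffel g p (chartAt E p p) (vectorFieldInChart p X (chartAt E p p)) : E →L[ℝ] E)

/-- The Laplace–Beltrami operator on real functions. -/
def laplacian (u : M → ℝ) (p : M) : ℝ := divergence g (gradient g u) p

/-- The gradient `∇φ = ∇(Re φ) + i ∇(Im φ)` of a complex function, as an element of the complexified
tangent space; `X + iY` is written as the pair `(X, Y)`. -/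
def complexGradient (φ : M → ℂ) (p : M) : TangentSpace 𝓘(ℝ, E) p × TangentSpace 𝓘(ℝ, E) p :=
  (gradient g (fun q => (φ q).re) p, gradient g (fun q => (φ q).im) p)

/-- The complex bilinear extension of the metric to the complexified tangent space. -/
def complexMetric (p : M) (Z W : TangentSpace 𝓘(ℝ, E) p × TangentSpace 𝓘(ℝ, E) p) : ℂ :=
  ⟨g.inner p Z.1 W.1 - g.inner p Z.2 W.2, g.inner p Z.1 W.2 + g.inner p Z.2 W.1⟩

/-- The tension field (the complex linear Laplace–Beltrami operator) `τ(φ)`. -/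
def tension (φ : M → ℂ) (p : M) : ℂ :=
  ⟨laplacian g (fun q => (φ q).re) p, laplacian g (fun q => (φ q).im) p⟩

/-- The conformality operator `κ(φ, ψ) = g(∇φ, ∇ψ)`. -/
def conformality (φ ψ : M → ℂ) (p : M) : ℂ :=
  complexMetric g p (complexGradient g φ p) (complexGradient g ψ p)

/-- A (smooth) complex-valued function which is eigen with respect to both `τ` and `κ`. -/
def IsEigenfunction (φ : M → ℂ) : Prop :=
  ContMDiff 𝓘(ℝ, E) 𝓘(ℝ, ℂ) ∞ φ ∧
    ∃ lam mu : ℂ, ∀ p, tension g φ p = lam * φ p ∧ conformality g φ φ p = mu * φ p ^ 2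

/-- `f : V → M` is a local parametrisation of the subset `S` of `M`: an injective smooth immersion
of an open subset `V` of `ℝ^k`, which is a homeomorphism onto a relatively open subset of `S`. -/
structure IsLocalParametrization (S : Set M) {k : ℕ} (V : Set (EuclideanSpace ℝ (Fin k)))
    (f : EuclideanSpace ℝ (Fin k) → M) : Prop where
  isOpen : IsOpen V
  contMDiffOn : ContMDiffOn 𝓘(ℝ, EuclideanSpace ℝ (Fin k)) 𝓘(ℝ, E) ∞ f V
  injective_mfderiv : ∀ y ∈ V,
    Function.Injective (mfderiv 𝓘(ℝ, EuclideanSpace ℝ (Fin k)) 𝓘(ℝ, E) f y)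
  isEmbedding : Topology.IsEmbedding (fun y : V => f y)
  image_eq : ∃ U : Set M, IsOpen U ∧ f '' V = S ∩ U

/-- `S` is a (smooth, embedded) submanifold of `M` of dimension `k`. -/
def IsSubmanifold (S : Set M) (k : ℕ) : Prop :=
  ∀ p ∈ S, ∃ (V : Set (EuclideanSpace ℝ (Fin k))) (f : EuclideanSpace ℝ (Fin k) → M),
    IsLocalParametrization (E := E) S V f ∧ p ∈ f '' V

section SecondFundamentalForm

variable {k : ℕ} (f : EuclideanSpace ℝ (Fin k) → M) (y : EuclideanSpace ℝ (Fin k))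

/-- The parametrisation `f` read in the preferred chart at `f y`. -/
def paramInChart (y' : EuclideanSpace ℝ (Fin k)) : E := chartAt E (f y) (f y')

/-- The coordinate vector field `∂_i f` at `y`. -/
def coordTangent (i : Fin k) : E :=
  fderiv ℝ (paramInChart (E := E) f y) y (EuclideanSpace.single i 1)

/-- The covariant derivative `∇_{∂_i f} ∂_j f` at `y`. -/
def coordCovDeriv (i j : Fin k) : E :=
  fderiv ℝ (fderiv ℝ (paramInChart (E := E) f y)) y (EuclideanSpace.single i 1)
      (EuclideanSpace.single j 1)
    + christoffel g (f y) (chartAt E (f y) (f y)) (coordTangent f y j) (coordTangent f y i)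

/-- The scalar product of `M` at `f y`, in the preferred chart at `f y`. -/
def metricAt (v w : E) : ℝ := metricInChart g (f y) (chartAt E (f y) (f y)) v w

/-- The first fundamental form `h_ij = g(∂_i f, ∂_j f)`. -/
def firstFundamentalForm : Matrix (Fin k) (Fin k) ℝ :=
  Matrix.of fun i j => metricAt g f y (coordTangent f y i) (coordTangent f y j)

/-- The component of a vector normal to the image of `f`:
`v - ∑ h^{ij} g(v, ∂_i f) ∂_j f`. -/
def normalPart (v : E) : E :=
  v - ∑ i, ∑ j, ((firstFundamentalForm (E := E) g f y)⁻¹ i j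
    * metricAt g f y v (coordTangent f y i)) • coordTangent f y j

/-- The second fundamental form `(∇_{∂_i f} ∂_j f)^⊥`. -/
def secondFundamentalForm (i j : Fin k) : E := normalPart g f y (coordCovDeriv g f y i j)

/-- The mean curvature vector `H = (1/k) ∑ h^{ij} (∇_{∂_i f} ∂_j f)^⊥`. -/
def meanCurvature : E :=
  (1 / (k : ℝ)) • ∑ i, ∑ j,
    (firstFundamentalForm (E := E) g f y)⁻¹ i j • secondFundamentalForm g f y i j

end SecondFundamentalForm

/-- `S` is a minimal submanifold of `M` of codimension `c`: an embedded submanifold whose mean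
curvature vanishes (computed in any local parametrisation). -/
def IsMinimalSubmanifold (S : Set M) (c : ℕ) : Prop :=
  ∃ k : ℕ, k + c = Module.finrank ℝ E ∧ IsSubmanifold (E := E) S k ∧
    ∀ (V : Set (EuclideanSpace ℝ (Fin k))) (f : EuclideanSpace ℝ (Fin k) → M),
      IsLocalParametrization (E := E) S V f → ∀ y ∈ V, meanCurvature g f y = 0

end RiemannianGeometry

/-- The set `Σ_n` of parameters. -/
def paramSet (n : ℕ) : Set (EuclideanSpace ℂ (Fin n)) := {a | ∀ k, a k ≠ 0}

/-- The function `Φ_a[z] = (∑_k a_k z_k \bar z_{n+k}) / |z|²` on `ℂP^{2n-1}`. -/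
def projPhi (n : ℕ) (a : EuclideanSpace ℂ (Fin n)) : CProj (2 * n - 1) → ℂ :=
  Projectivization.lift
    (fun z : CProj.NZ (2 * n - 1) =>
      (∑ k : Fin n, a k * z.1 ⟨k, by have := k.isLt; omega⟩ *
        (starRingEnd ℂ) (z.1 ⟨n + k, by have := k.isLt; omega⟩)) / (‖z.1‖ : ℂ) ^ 2)
    (by
      rintro ⟨z, hz⟩ ⟨w, hw⟩ t (rfl : z = t • w)
      have ht : t ≠ 0 := fun h => hz (by simp [h])
      have h1 : (starRingEnd ℂ) t ≠ 0 := by simpa using ht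
      have h2 : ((‖t • w‖ : ℝ) : ℂ) ^ 2 = (t * (starRingEnd ℂ) t) * (‖w‖ : ℂ) ^ 2 := by
        rw [norm_smul, Complex.mul_conj, Complex.normSq_eq_norm_sq]
        push_cast
        ring
      simp only [h2, PiLp.smul_apply, smul_eq_mul, map_mul]
      conv_rhs => rw [← mul_div_mul_left _ _ (mul_ne_zero ht h1), Finset.mul_sum]
      congr 1
      exact Finset.sum_congr rfl fun k _ => by ring)

end

/-! Write `Φ_a([z]) = ⟨z, C z⟩ / |z|²`, where `C` sends `e_k` to `a_k e_{n+k}` and kills every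
`e_{n+k}`; then `C² = 0` and `tr C = 0`. Splitting `C = A + iB` with `A`, `B` Hermitian makes the
real and imaginary parts of `Φ_a` Rayleigh quotients `u_A`, `u_B`. On `ℂP^m` the gradient of `u_A`
is the image of `2Az` under the projection. This yields `Δu_A = 4 tr A - 4(m+1) u_A`
(`laplacian_eq`) and `g(∇u_A, ∇u_B) = 4 (Re⟨Az, Bz⟩ / |z|² - u_A u_B)` (`inner_gradient_gradient`).
The vanishing trace gives `τ(Φ_a) = -4(m+1) Φ_a`, and `⟨Cz, C*z⟩ = ⟨C²z, z⟩ = 0` gives `κ(Φ_a, Φ_a)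
= -4 Φ_a²`. At a zero where the gradient also vanishes, `Cz = C*z = 0`, which forces `z = 0` when
all `a_k ≠ 0`; so the zero fibre is regular.

Minimality is a general fact about eigenfunctions `φ = u + iv` on a Riemannian manifold
(`IsEigenfunction.isMinimalSubmanifold`). At a zero, `κ = μφ²` vanishes, so `X = ∇u` and `Y = ∇v`
are orthogonal of equal length. If they are non-zero, `dφ` is onto and the fibre is a submanifold
with normal plane spanned by `X`, `Y`. The derivative of `μφ²` vanishes there too, and
differentiating `κ` shows that the Hessians of `u` and `v` are trace-free on that plane
(`IsMetricNear.coordHessian_add_eq_zero`). Since `τ(φ) = λφ = 0`, their tangential traces vanish as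
well. Differentiating `u ∘ f = 0` twice along a parametrisation `f` identifies these traces, up to
sign and the factor `1/k`, with the normal components of the mean curvature, which is therefore
zero.

The parameter count rests on linearity of `Φ_a` in `a`, and on test points of the zero fibre at
which the equation for `b` becomes `b_o a_k = b_k a_o` (`preimage_projPhi_eq_iff`). -/

noncomputable section

namespace RiemannianGeometry

open Filter Topology

/-! ### Levi-Civita calculus for a metric on a coordinate space. -/

section Coordinates

variable {E : Type*} [NormedAddCommGroup E] [NormedSpace ℝ E]

/-- Positivity makes `v ↦ B v` injective, and `E` and its dual have the same finite dimension. -/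
theorem isInvertible_of_pos [FiniteDimensional ℝ E] {B : E →L[ℝ] E →L[ℝ] ℝ} (hB : ∀ v, v ≠ 0 → 0 < B v v) :
    B.IsInvertible := by
  have hker : ∀ v, B v = 0 → v = 0 := fun v hv => by
    by_contra h
    simpa [hv] using hB v h
  have hinj : Function.Injective B := (injective_iff_map_eq_zero B).2 hker
  have hdim : Module.finrank ℝ E = Module.finrank ℝ (E →L[ℝ] ℝ) :=
    (LinearEquiv.finrank_eq (LinearMap.toContinuousLinearMap (𝕜 := ℝ) (E := E) (F' := ℝ)) ▸
      (Subspace.dual_finrank_eq (K := ℝ) (V := E)).symm)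
  exact ⟨(LinearEquiv.ofInjectiveOfFinrankEq (B : E →ₗ[ℝ] E →L[ℝ] ℝ) hinj
    hdim).toContinuousLinearEquiv, rfl⟩

/-- `G` is a differentiable Riemannian metric near the point `x` of the coordinate space `E`. -/
structure IsMetricNear (G : E → E →L[ℝ] E →L[ℝ] ℝ) (x : E) : Prop where
  symm : ∀ᶠ y in 𝓝 x, ∀ v w, G y v w = G y w v
  pos : ∀ᶠ y in 𝓝 x, ∀ v, v ≠ 0 → 0 < G y v v
  differentiableAt : DifferentiableAt ℝ G x

/-- The Christoffel symbols of the metric `G` on the coordinate space `E`. -/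
def coordChristoffel (G : E → E →L[ℝ] E →L[ℝ] ℝ) (x : E) (w : E) : E →L[ℝ] E :=
  (G x).inverse ∘L ((1 / 2 : ℝ) •
    (fderiv ℝ G x w + (fderiv ℝ G x).flip w - ((fderiv ℝ G x).flip w).flip))

/-- The Hessian of `u` with respect to the metric `G` on the coordinate space `E`. -/
def coordHessian (G : E → E →L[ℝ] E →L[ℝ] ℝ) (u : E → ℝ) (x v w : E) : ℝ :=
  fderiv ℝ (fderiv ℝ u) x v w - fderiv ℝ u x (coordChristoffel G x w v)

/-- `X` is the gradient of `u` with respect to the metric `G`, near the point `x`. -/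
def IsGradientNear (G : E → E →L[ℝ] E →L[ℝ] ℝ) (u : E → ℝ) (X : E → E) (x : E) : Prop :=
  ∀ᶠ y in 𝓝 x, ∀ w, G y (X y) w = fderiv ℝ u y w

variable {G : E → E →L[ℝ] E →L[ℝ] ℝ} {x : E}

/-- Koszul's formula in coordinates. It avoids the inverse metric, so later identities between
Christoffel symbols reduce to linear arithmetic in the derivatives of `G`. -/
theorem two_mul_coordChristoffel (h : (G x).IsInvertible) (v w u : E) :
    2 * G x (coordChristoffel G x w v) u =
      fderiv ℝ G x w v u + fderiv ℝ G x v w u - fderiv ℝ G x u w v := by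
  simp only [coordChristoffel, ContinuousLinearMap.comp_apply, h.self_apply_inverse]
  simp

namespace IsMetricNear

theorem fderiv_apply (hG : IsMetricNear G x) (v a b : E) :
    fderiv ℝ (fun y => G y a b) x v = fderiv ℝ G x v a b := by
  have h := (hG.differentiableAt.hasFDerivAt.clm_apply (hasFDerivAt_const a x)).clm_apply
    (hasFDerivAt_const b x)
  rw [h.fderiv]
  simp

theorem fderiv_symm (hG : IsMetricNear G x) (v a b : E) :
    fderiv ℝ G x v a b = fderiv ℝ G x v b a := by
  rw [← hG.fderiv_apply, ← hG.fderiv_apply]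
  refine congrArg (fun L : E →L[ℝ] ℝ => L v) (EventuallyEq.fderiv_eq ?_)
  filter_upwards [hG.symm] with y hy using hy a b

variable [FiniteDimensional ℝ E]

theorem isInvertible (hG : IsMetricNear G x) : (G x).IsInvertible :=
  isInvertible_of_pos hG.pos.self_of_nhds

theorem coordChristoffel_symm (hG : IsMetricNear G x) (v w : E) :
    coordChristoffel G x w v = coordChristoffel G x v w := by
  refine hG.isInvertible.injective (ContinuousLinearMap.ext fun u => ?_)
  have h1 := two_mul_coordChristoffel hG.isInvertible v w u
  have h2 := two_mul_coordChristoffel hG.isInvertible w v u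
  have h3 := hG.fderiv_symm u v w
  linarith

theorem coordHessian_symm (hG : IsMetricNear G x) {u : E → ℝ} (hu : ContDiffAt ℝ 2 u x)
    (v w : E) : coordHessian G u x v w = coordHessian G u x w v := by
  have h : IsSymmSndFDerivAt ℝ u x := hu.isSymmSndFDerivAt (by simp)
  rw [coordHessian, coordHessian, hG.coordChristoffel_symm, h.eq]

variable {u u' : E → ℝ} {X Y : E → E}

/-- Near `x` the field is `G⁻¹ du`; inversion is smooth at an invertible operator, and `du` is of
class `C¹`. -/
theorem differentiableAt_gradient (hG : IsMetricNear G x) (hu : ContDiffAt ℝ 2 u x)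
    (hX : IsGradientNear G u X x) : DifferentiableAt ℝ X x := by
  have h1 : DifferentiableAt ℝ (fun y => (G y).inverse) x :=
    ((hG.isInvertible.contDiffAt_map_inverse (n := 1)).differentiableAt (by simp)).comp x
      hG.differentiableAt
  have h2 : DifferentiableAt ℝ (fderiv ℝ u) x :=
    (hu.fderiv_right (m := 1) (by norm_num)).differentiableAt (by simp)
  refine (h1.clm_apply h2).congr_of_eventuallyEq ?_
  filter_upwards [hX, hG.pos] with y hy hpos
  have h3 : G y (X y) = fderiv ℝ u y := ContinuousLinearMap.ext hy
  rw [← h3, (isInvertible_of_pos hpos).inverse_apply_self]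

/-- The derivative of `y ↦ G_y(X_y, w)`. -/
theorem fderiv_apply_gradient (hG : IsMetricNear G x) (hu : ContDiffAt ℝ 2 u x)
    (hX : IsGradientNear G u X x) (v w : E) :
    fderiv ℝ (fderiv ℝ u) x v w = fderiv ℝ G x v (X x) w + G x (fderiv ℝ X x v) w := by
  have h2 : DifferentiableAt ℝ (fderiv ℝ u) x :=
    (hu.fderiv_right (m := 1) (by norm_num)).differentiableAt (by simp)
  have h1 := (hG.differentiableAt.hasFDerivAt.clm_apply
    (hG.differentiableAt_gradient hu hX).hasFDerivAt)
  have h3 : (fun y => G y (X y)) =ᶠ[𝓝 x] fderiv ℝ u := by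
    filter_upwards [hX] with y hy using ContinuousLinearMap.ext hy
  rw [← h3.fderiv_eq, h1.fderiv]
  simp [add_comm]

/-- The covariant derivative of the gradient is the Hessian. -/
theorem apply_covDeriv_gradient (hG : IsMetricNear G x) (hu : ContDiffAt ℝ 2 u x)
    (hX : IsGradientNear G u X x) (v w : E) :
    G x (fderiv ℝ X x v + coordChristoffel G x (X x) v) w = coordHessian G u x v w := by
  have h1 := hG.fderiv_apply_gradient hu hX v w
  -- Metric compatibility: the two Koszul formulas for `Γ(v, X)` against `w` and `Γ(v, w)` against
  -- `X` add up to `2 (D_v G)(X, w)`.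
  have h2 := two_mul_coordChristoffel hG.isInvertible v (X x) w
  have h3 := two_mul_coordChristoffel hG.isInvertible v w (X x)
  have h4 := hX.self_of_nhds (coordChristoffel G x w v)
  rw [hG.symm.self_of_nhds] at h4
  have h5 := hG.fderiv_symm v (X x) w
  have h6 := hG.fderiv_symm w (X x) v
  have h7 := hG.fderiv_symm (X x) w v
  rw [coordHessian, map_add, _root_.add_apply, h1]
  linarith

/-- The derivative of the scalar product of two gradients. -/
theorem fderiv_inner_gradient (hG : IsMetricNear G x) (hu : ContDiffAt ℝ 2 u x)
    (hu' : ContDiffAt ℝ 2 u' x) (hX : IsGradientNear G u X x) (hY : IsGradientNear G u' Y x)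
    (v : E) : HasFDerivAt (fun y => G y (X y) (Y y)) (fderiv ℝ (fun y => G y (X y) (Y y)) x) x ∧
    fderiv ℝ (fun y => G y (X y) (Y y)) x v =
      coordHessian G u x v (Y x) + coordHessian G u' x v (X x) := by
  have h1 := ((hG.differentiableAt.hasFDerivAt.clm_apply
    (hG.differentiableAt_gradient hu hX).hasFDerivAt).clm_apply
    (hG.differentiableAt_gradient hu' hY).hasFDerivAt)
  refine ⟨h1.differentiableAt.hasFDerivAt, ?_⟩
  rw [h1.fderiv, ← hG.apply_covDeriv_gradient hu hX, ← hG.apply_covDeriv_gradient hu' hY]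
  have h2 := two_mul_coordChristoffel hG.isInvertible v (X x) (Y x)
  have h3 := two_mul_coordChristoffel hG.isInvertible v (Y x) (X x)
  have h5 := hG.fderiv_symm v (X x) (Y x)
  have h6 := hG.fderiv_symm (Y x) (X x) v
  have h7 := hG.fderiv_symm (X x) (Y x) v
  have h8 := hG.symm.self_of_nhds (X x) (fderiv ℝ Y x v)
  simp
  linarith

end IsMetricNear

end Coordinates

/-! ### Gram matrices, and traces in a frame adapted to a submanifold of codimension two. -/

section LinearAlgebra

variable {E : Type*} [NormedAddCommGroup E] [NormedSpace ℝ E] {k : ℕ}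
  {B : E →L[ℝ] E →L[ℝ] ℝ} {t : Fin k → E}

/-- A kernel vector `c` of the Gram matrix makes `∑ c_j t_j` orthogonal to every `t_i`, hence to
itself. -/
theorem isUnit_det_gram (hpos : ∀ v, v ≠ 0 → 0 < B v v) (ht : LinearIndependent ℝ t) :
    IsUnit (Matrix.of fun i j => B (t i) (t j)).det := by
  rw [isUnit_iff_ne_zero]
  intro h
  obtain ⟨c, hc, hc'⟩ := Matrix.exists_mulVec_eq_zero_iff.2 h
  have h1 : ∑ j, c j • t j = 0 := by
    by_contra h0
    have h2 := hpos _ h0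
    have h3 : ∀ i, B (t i) (∑ j, c j • t j) = 0 := fun i => by
      have := congrFun hc' i
      simp only [Matrix.mulVec, dotProduct, Matrix.of_apply, Pi.zero_apply] at this
      simp only [map_sum, map_smul, smul_eq_mul, ← this]
      exact Finset.sum_congr rfl fun j _ => mul_comm _ _
    have h4 : B (∑ j, c j • t j) (∑ j, c j • t j) = 0 := by
      conv_lhs => enter [1]; rw [map_sum]
      rw [_root_.sum_apply]
      refine Finset.sum_eq_zero fun i _ => ?_
      rw [map_smul, _root_.smul_apply, h3, smul_zero]
    exact h2.ne' h4
  exact hc (funext (Fintype.linearIndependent_iff.1 ht c h1))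

/-- A vector orthogonal to `t_1, …, t_k` and to two further vectors, which together with the `t_i`
span the whole space, vanishes. -/
theorem eq_zero_of_orthogonal [FiniteDimensional ℝ E] (hpos : ∀ v, v ≠ 0 → 0 < B v v)
    (ht : LinearIndependent ℝ t) (hk : k + 2 = Module.finrank ℝ E) {X Y : E} {ρ : ℝ} (hρ : ρ ≠ 0)
    (hX : B X X = ρ) (hY : B Y Y = ρ) (hXY : B X Y = 0) (hYX : B Y X = 0)
    (htX : ∀ i, B X (t i) = 0) (htY : ∀ i, B Y (t i) = 0) {r : E}
    (hr : ∀ i, B r (t i) = 0) (hrX : B r X = 0) (hrY : B r Y = 0) : r = 0 := by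
  have hli : LinearIndependent ℝ (Sum.elim t ![X, Y]) := by
    rw [Fintype.linearIndependent_iff]
    intro c hc
    simp only [Fintype.sum_sum_type, Sum.elim_inl, Sum.elim_inr, Fin.sum_univ_two,
      Matrix.cons_val_zero, Matrix.cons_val_one] at hc
    have h1 : c (Sum.inr 0) = 0 := by
      have := congrArg (B X) hc
      simpa [htX, hX, hXY, hρ] using this
    have h2 : c (Sum.inr 1) = 0 := by
      have := congrArg (B Y) hc
      simpa [htY, hY, hYX, hρ] using this
    rw [h1, h2, zero_smul, zero_smul, add_zero, add_zero] at hc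
    have h3 := Fintype.linearIndependent_iff.1 ht _ hc
    rintro (i | i)
    · exact h3 i
    · fin_cases i
      · exact h1
      · exact h2
  have hspan := hli.span_eq_top_of_card_eq_finrank' (by simp [hk])
  have h0 : ∀ w, B r w = 0 := fun w => by
    have hw : w ∈ Submodule.span ℝ (Set.range (Sum.elim t ![X, Y])) := hspan ▸ Submodule.mem_top
    induction hw using Submodule.span_induction with
    | mem w hw =>
      obtain ⟨i | i, rfl⟩ := hw
      · exact hr i
      · fin_cases i
        · exact hrX
        · exact hrY
    | zero => simp
    | add a b _ _ ha hb => rw [map_add, ha, hb, add_zero]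
    | smul c a _ ha => rw [map_smul, ha, smul_zero]
  by_contra h
  exact (hpos r h).ne' (h0 r)

/-- Subtracting the tangential part makes a vector orthogonal to the `t_l`. -/
theorem sum_gram_inv_mul (hpos : ∀ v, v ≠ 0 → 0 < B v v) (ht : LinearIndependent ℝ t) (v : E)
    (l : Fin k) :
    B (∑ i, ∑ j, ((Matrix.of fun i j => B (t i) (t j))⁻¹ i j * B v (t i)) • t j) (t l) =
      B v (t l) := by
  have hdet := isUnit_det_gram hpos ht
  set h : Matrix (Fin k) (Fin k) ℝ := Matrix.of fun i j => B (t i) (t j) with hh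
  have h1 : ∀ i, ∑ j, h⁻¹ i j * h j l = (1 : Matrix (Fin k) (Fin k) ℝ) i l := fun i => by
    rw [← Matrix.nonsing_inv_mul h hdet, Matrix.mul_apply]
  simp only [map_sum, _root_.sum_apply, map_smul, _root_.smul_apply,
    smul_eq_mul]
  have h2 : ∀ i, ∑ j, h⁻¹ i j * B v (t i) * B (t j) (t l) =
      B v (t i) * (1 : Matrix (Fin k) (Fin k) ℝ) i l := fun i => by
    rw [← h1, Finset.mul_sum]
    refine Finset.sum_congr rfl fun j _ => ?_
    simp only [hh, Matrix.of_apply]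
    ring
  simp [h2, Matrix.one_apply]

/-- The trace of an endomorphism in terms of a frame `t_1, …, t_k` and two orthogonal vectors of
equal length orthogonal to it. -/
theorem trace_eq_sum_frame [FiniteDimensional ℝ E] (hsymm : ∀ v w, B v w = B w v)
    (hpos : ∀ v, v ≠ 0 → 0 < B v v)
    (ht : LinearIndependent ℝ t) (hk : k + 2 = Module.finrank ℝ E) {X Y : E} {ρ : ℝ} (hρ : ρ ≠ 0)
    (hX : B X X = ρ) (hY : B Y Y = ρ) (hXY : B X Y = 0)
    (htX : ∀ i, B X (t i) = 0) (htY : ∀ i, B Y (t i) = 0) (S : E →L[ℝ] E) :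
    LinearMap.trace ℝ E S =
      ∑ i, ∑ j, (Matrix.of fun i j => B (t i) (t j))⁻¹ i j * B (S (t j)) (t i) +
        (B (S X) X + B (S Y) Y) / ρ := by
  have hYX : B Y X = 0 := by rw [hsymm, hXY]
  -- Expansion of `v` in the frame: the difference of the two sides is orthogonal to all `t_i`, `X`
  -- and `Y`, so it vanishes.
  have hexp : ∀ v, v = ∑ i, ∑ j, ((Matrix.of fun i j => B (t i) (t j))⁻¹ i j * B v (t i)) • t j +
      (B v X / ρ) • X + (B v Y / ρ) • Y := fun v => by
    rw [← sub_eq_zero]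
    have h0 : ∀ w, (∀ i, B w (t i) = 0) → B (∑ i, ∑ j,
        ((Matrix.of fun i j => B (t i) (t j))⁻¹ i j * B v (t i)) • t j) w = 0 := fun w hw => by
      simp only [map_sum, _root_.sum_apply, map_smul, _root_.smul_apply,
        hsymm _ w, hw, smul_zero, Finset.sum_const_zero]
    refine eq_zero_of_orthogonal hpos ht hk hρ hX hY hXY hYX htX htY (fun l => ?_) ?_ ?_
    · simp [sum_gram_inv_mul hpos ht v l, htX, htY, -map_sum]
    · have := h0 X htX
      simp [this, hX, hYX, hρ, -map_sum]
    · have := h0 Y htY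
      simp [this, hY, hXY, hρ, -map_sum]
  -- Applying `S` to this expansion writes it as a sum of rank-one maps `v ↦ B(v, a) s`, each of
  -- trace `B(s, a)`.
  have hS : (S : E →ₗ[ℝ] E) = ∑ i, ∑ j, (Matrix.of fun i j => B (t i) (t j))⁻¹ i j •
      ((B.flip (t i) : E →L[ℝ] ℝ) : E →ₗ[ℝ] ℝ).smulRight (S (t j)) +
      ρ⁻¹ • ((B.flip X : E →L[ℝ] ℝ) : E →ₗ[ℝ] ℝ).smulRight (S X) +
      ρ⁻¹ • ((B.flip Y : E →L[ℝ] ℝ) : E →ₗ[ℝ] ℝ).smulRight (S Y) := by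
    ext v
    have := congrArg S (hexp v)
    simp only [map_add, map_sum, map_smul] at this
    rw [ContinuousLinearMap.coe_coe, this]
    simp [smul_smul, LinearMap.sum_apply, div_eq_inv_mul]
  rw [hS]
  simp only [map_add, map_sum, map_smul, LinearMap.trace_smulRight]
  simp only [ContinuousLinearMap.coe_coe, ContinuousLinearMap.flip_apply, smul_eq_mul]
  field_simp
  ring

end LinearAlgebra

set_option linter.unusedSectionVars false

/-! ### Translation of metric, gradient and conformality operator into preferred charts. -/

section Charts

variable {E : Type*} [NormedAddCommGroup E] [NormedSpace ℝ E] [FiniteDimensional ℝ E]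
  {M : Type*} [TopologicalSpace M] [ChartedSpace E M] [IsManifold 𝓘(ℝ, E) ∞ M]
  (g : Bundle.ContMDiffRiemannianMetric 𝓘(ℝ, E) ∞ E (fun p : M => TangentSpace 𝓘(ℝ, E) p))

theorem christoffel_eq (p : M) : christoffel g p = coordChristoffel (metricInChart g p) := rfl

theorem metricInChart_apply (p : M) (x v w : E) :
    metricInChart g p x v w = g.inner ((chartAt E p).symm x)
      (mfderiv 𝓘(ℝ, E) 𝓘(ℝ, E) (chartAt E p).symm x v)
      (mfderiv 𝓘(ℝ, E) 𝓘(ℝ, E) (chartAt E p).symm x w) := rfl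

theorem isInvertible_inner (p : M) : (g.inner p).IsInvertible :=
  isInvertible_of_pos (E := E) (B := g.inner p) (g.pos p)

theorem mfderiv_chartAt_symm_mfderiv (p : M) {x : E} (hx : x ∈ (chartAt E p).target)
    (v : TangentSpace 𝓘(ℝ, E) ((chartAt E p).symm x)) :
    mfderiv 𝓘(ℝ, E) 𝓘(ℝ, E) (chartAt E p).symm x
      (mfderiv 𝓘(ℝ, E) 𝓘(ℝ, E) (chartAt E p) ((chartAt E p).symm x) v) = v := by
  have : IsManifold 𝓘(ℝ, E) 1 M := .of_le (n := ∞) (by simp)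
  have h := (mdifferentiable_chart (I := 𝓘(ℝ, E)) p).symm.comp_symm_deriv (x := (chartAt E p).symm x)
    ((chartAt E p).map_target hx)
  rw [OpenPartialHomeomorph.symm_symm, (chartAt E p).right_inv hx] at h
  exact congrArg (fun L : E →L[ℝ] E => L v) h

theorem mfderiv_chartAt_mfderiv_symm (p : M) {x : E} (hx : x ∈ (chartAt E p).target) (v : E) :
    mfderiv 𝓘(ℝ, E) 𝓘(ℝ, E) (chartAt E p) ((chartAt E p).symm x)
      (mfderiv 𝓘(ℝ, E) 𝓘(ℝ, E) (chartAt E p).symm x v) = v := by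
  have : IsManifold 𝓘(ℝ, E) 1 M := .of_le (n := ∞) (by simp)
  exact congrArg (fun L : E →L[ℝ] E => L v)
    ((mdifferentiable_chart (I := 𝓘(ℝ, E)) p).comp_symm_deriv (x := x) hx)

/-- Smoothness of `g` is a statement about its representative in the bundle trivialisation at `p`.
The inverse of the tangent trivialisation is the derivative of the inverse chart, so that
representative, composed with the inverse chart, is `metricInChart` near the point. -/
theorem contDiffAt_metricInChart (p : M) :
    ContDiffAt ℝ ∞ (metricInChart g p) (chartAt E p p) := by
  have : IsManifold 𝓘(ℝ, E) 1 M := .of_le (n := ∞) (by simp)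
  have h1 := (Bundle.contMDiffAt_section p).1 (g.contMDiff p)
  have h2 : ContMDiffAt 𝓘(ℝ, E) 𝓘(ℝ, E) ∞ (chartAt E p).symm (chartAt E p p) :=
    contMDiffOn_chart_symm.contMDiffAt
      ((chartAt E p).open_target.mem_nhds ((chartAt E p).map_source (mem_chart_source E p)))
  have hp : (chartAt E p).symm (chartAt E p p) = p := (chartAt E p).left_inv (mem_chart_source E p)
  rw [← hp] at h1
  have h3 := ContMDiffAt.comp (chartAt E p p) h1 h2
  rw [hp] at h3
  rw [contMDiffAt_iff_contDiffAt] at h3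
  refine h3.congr_of_eventuallyEq ?_
  filter_upwards [(chartAt E p).open_target.mem_nhds
    ((chartAt E p).map_source (mem_chart_source E p))] with x hx
  have hq : (chartAt E p).symm x ∈ (chartAt E p).source := (chartAt E p).map_target hx
  rw [Function.comp_apply, hom_trivializationAt_apply]
  ext v u
  rw [inCoordinates_apply_eq₂ (by simpa using hq) (by simpa using hq) (by simp)]
  have hsymm : ∀ v, (trivializationAt E (TangentSpace 𝓘(ℝ, E)) p).symm
      ((chartAt E p).symm x) v = mfderiv 𝓘(ℝ, E) 𝓘(ℝ, E) (chartAt E p).symm x v := fun v => by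
    refine (Bundle.Trivialization.symmL_apply (R := ℝ) _ (by simpa using hq) v).symm.trans ?_
    have h := TangentBundle.symmL_trivializationAt (I := 𝓘(ℝ, E)) hq
    have h' : extChartAt 𝓘(ℝ, E) p ((chartAt E p).symm x) = x := by
      simp [(chartAt E p).right_inv hx]
    rw [h', modelWithCornersSelf_coe, Set.range_id, mfderivWithin_univ] at h
    exact congrArg (fun L : E →L[ℝ] E => L v) h
  rw [hsymm, hsymm, metricInChart_apply]
  simp only [Bundle.Trivial.linearMapAt_trivialization,
    Bundle.Trivial.fiberBundle_trivializationAt']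
  rfl

theorem eventually_mem_chartAt_target (p : M) : ∀ᶠ x in 𝓝 (chartAt E p p),
    x ∈ (chartAt E p).target :=
  (chartAt E p).open_target.mem_nhds ((chartAt E p).map_source (mem_chart_source E p))

theorem metricInChart_symm (p : M) (x v w : E) :
    metricInChart g p x v w = metricInChart g p x w v := by
  rw [metricInChart_apply, metricInChart_apply, g.symm]

theorem metricInChart_pos (p : M) {x : E} (hx : x ∈ (chartAt E p).target) {v : E} (hv : v ≠ 0) :
    0 < metricInChart g p x v v := by
  rw [metricInChart_apply]
  refine g.pos _ _ fun h => hv ?_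
  rw [← mfderiv_chartAt_mfderiv_symm p hx v, h]
  exact map_zero (mfderiv 𝓘(ℝ, E) 𝓘(ℝ, E) (chartAt E p) ((chartAt E p).symm x))

theorem isMetricNear_metricInChart (p : M) :
    IsMetricNear (metricInChart g p) (chartAt E p p) where
  symm := Eventually.of_forall fun x v w => metricInChart_symm g p x v w
  pos := by
    filter_upwards [eventually_mem_chartAt_target p] with x hx v hv
    exact metricInChart_pos g p hx hv
  differentiableAt := (contDiffAt_metricInChart g p).differentiableAt (by simp)

theorem inner_gradient (u : M → ℝ) (p : M) (v : TangentSpace 𝓘(ℝ, E) p) :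
    g.inner p (gradient g u p) v = mfderiv 𝓘(ℝ, E) 𝓘(ℝ, ℝ) u p v := by
  rw [gradient]
  exact congrArg (fun L : E →L[ℝ] ℝ => L v) ((isInvertible_inner g p).self_apply_inverse _)

theorem fderiv_comp_chartAt_symm {F : Type*} [NormedAddCommGroup F] [NormedSpace ℝ F] {u : M → F}
    (hu : ContMDiff 𝓘(ℝ, E) 𝓘(ℝ, F) ∞ u) (p : M) {x : E} (hx : x ∈ (chartAt E p).target) (v : E) :
    fderiv ℝ (u ∘ (chartAt E p).symm) x v = mfderiv 𝓘(ℝ, E) 𝓘(ℝ, F) u ((chartAt E p).symm x)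
      (mfderiv 𝓘(ℝ, E) 𝓘(ℝ, E) (chartAt E p).symm x v) := by
  have : IsManifold 𝓘(ℝ, E) 1 M := .of_le (n := ∞) (by simp)
  have h := mfderiv_comp x (hu.mdifferentiable (by simp) ((chartAt E p).symm x))
    (mdifferentiableAt_atlas_symm (I := 𝓘(ℝ, E)) (chart_mem_atlas E p) hx)
  rw [← mfderiv_eq_fderiv, h]
  rfl

theorem metricInChart_vectorField (p : M) {x : E} (hx : x ∈ (chartAt E p).target)
    (X Y : ∀ q : M, TangentSpace 𝓘(ℝ, E) q) :
    metricInChart g p x (vectorFieldInChart p X x) (vectorFieldInChart p Y x) =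
      g.inner ((chartAt E p).symm x) (X ((chartAt E p).symm x)) (Y ((chartAt E p).symm x)) := by
  rw [metricInChart_apply]
  simp only [vectorFieldInChart]
  rw [mfderiv_chartAt_symm_mfderiv p hx, mfderiv_chartAt_symm_mfderiv p hx]

variable {u : M → ℝ}

theorem metricInChart_gradient (hu : ContMDiff 𝓘(ℝ, E) 𝓘(ℝ, ℝ) ∞ u) (p : M) {x : E}
    (hx : x ∈ (chartAt E p).target) (w : E) :
    metricInChart g p x (vectorFieldInChart p (gradient g u) x) w =
      fderiv ℝ (u ∘ (chartAt E p).symm) x w := by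
  rw [metricInChart_apply, fderiv_comp_chartAt_symm hu p hx, ← inner_gradient g]
  simp only [vectorFieldInChart]
  rw [mfderiv_chartAt_symm_mfderiv p hx]

theorem isGradientNear_gradient (hu : ContMDiff 𝓘(ℝ, E) 𝓘(ℝ, ℝ) ∞ u) (p : M) :
    IsGradientNear (metricInChart g p) (u ∘ (chartAt E p).symm)
      (vectorFieldInChart p (gradient g u)) (chartAt E p p) := by
  filter_upwards [eventually_mem_chartAt_target p] with x hx w
  exact metricInChart_gradient g hu p hx w

theorem contDiffAt_comp_chartAt_symm {F : Type*} [NormedAddCommGroup F] [NormedSpace ℝ F]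
    {u : M → F} (hu : ContMDiff 𝓘(ℝ, E) 𝓘(ℝ, F) ∞ u) (p : M) {x : E}
    (hx : x ∈ (chartAt E p).target) : ContDiffAt ℝ ∞ (u ∘ (chartAt E p).symm) x := by
  rw [← contMDiffAt_iff_contDiffAt]
  exact hu.contMDiffAt.comp x
    (contMDiffOn_chart_symm.contMDiffAt ((chartAt E p).open_target.mem_nhds hx))

/-- Makes `κ(φ, φ) = μφ²` an identity of functions on the coordinate space, valid on the whole chart
and hence open to differentiation. -/
theorem conformality_eq (φ : M → ℂ) (p : M) {x : E} (hx : x ∈ (chartAt E p).target) :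
    conformality g φ φ ((chartAt E p).symm x) =
      ⟨metricInChart g p x (vectorFieldInChart p (gradient g fun q => (φ q).re) x)
          (vectorFieldInChart p (gradient g fun q => (φ q).re) x) -
        metricInChart g p x (vectorFieldInChart p (gradient g fun q => (φ q).im) x)
          (vectorFieldInChart p (gradient g fun q => (φ q).im) x),
        2 * metricInChart g p x (vectorFieldInChart p (gradient g fun q => (φ q).re) x)
          (vectorFieldInChart p (gradient g fun q => (φ q).im) x)⟩ := by
  simp only [metricInChart_vectorField g p hx]
  rw [conformality, complexMetric, complexGradient]
  congr 1
  rw [g.symm _ (gradient g (fun q => (φ q).im) _), two_mul]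

theorem contMDiff_re {φ : M → ℂ} (hφ : ContMDiff 𝓘(ℝ, E) 𝓘(ℝ, ℂ) ∞ φ) :
    ContMDiff 𝓘(ℝ, E) 𝓘(ℝ, ℝ) ∞ (fun q => (φ q).re) :=
  (Complex.reCLM.contDiff (n := ∞)).contMDiff.comp hφ

theorem contMDiff_im {φ : M → ℂ} (hφ : ContMDiff 𝓘(ℝ, E) 𝓘(ℝ, ℂ) ∞ φ) :
    ContMDiff 𝓘(ℝ, E) 𝓘(ℝ, ℝ) ∞ (fun q => (φ q).im) :=
  (Complex.imCLM.contDiff (n := ∞)).contMDiff.comp hφ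

end Charts

/-! ### The Hessian on the normal plane at a zero. -/

section NormalHessian

variable {E : Type*} [NormedAddCommGroup E] [NormedSpace ℝ E] [FiniteDimensional ℝ E]
  {G : E → E →L[ℝ] E →L[ℝ] ℝ} {x : E}

/-- At a zero of a function with `κ(φ, φ) = μ φ²`, the Hessian of the function has trace zero on
the plane spanned by the gradients of the real and imaginary parts. -/
theorem IsMetricNear.coordHessian_add_eq_zero (hG : IsMetricNear G x) {φ : E → ℂ}
    (hφ : ContDiffAt ℝ 2 φ x) {X Y : E → E} (hX : IsGradientNear G (fun y => (φ y).re) X x)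
    (hY : IsGradientNear G (fun y => (φ y).im) Y x) (h0 : φ x = 0) {μ : ℂ}
    (hκ : ∀ᶠ y in 𝓝 x, G y (X y) (X y) - G y (Y y) (Y y) = (μ * φ y ^ 2).re ∧
      2 * G y (X y) (Y y) = (μ * φ y ^ 2).im) :
    coordHessian G (fun y => (φ y).re) x (X x) (X x) +
        coordHessian G (fun y => (φ y).re) x (Y x) (Y x) = 0 ∧
      coordHessian G (fun y => (φ y).im) x (X x) (X x) +
        coordHessian G (fun y => (φ y).im) x (Y x) (Y x) = 0 := by
  have hu : ContDiffAt ℝ 2 (fun y => (φ y).re) x := Complex.reCLM.contDiff.contDiffAt.comp x hφ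
  have hv : ContDiffAt ℝ 2 (fun y => (φ y).im) x := Complex.imCLM.contDiff.contDiffAt.comp x hφ
  -- Here the zero is used: the derivative `2μ φ dφ` of `μφ²` vanishes with `φ`.
  have hd : HasFDerivAt (fun y => μ * φ y ^ 2) (0 : E →L[ℝ] ℂ) x := by
    have h := ((hφ.differentiableAt (by simp)).hasFDerivAt.pow 2).const_mul μ
    refine h.congr_fderiv ?_
    ext v
    simp [h0]
  have hre : HasFDerivAt (fun y => (μ * φ y ^ 2).re) (0 : E →L[ℝ] ℝ) x := 
    (Complex.reCLM.hasFDerivAt.comp x hd).congr_fderiv (by simp)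
  have him : HasFDerivAt (fun y => (μ * φ y ^ 2).im) (0 : E →L[ℝ] ℝ) x := 
    (Complex.imCLM.hasFDerivAt.comp x hd).congr_fderiv (by simp)
  -- Derivative of the real part of `κ`: `Hess u(·, X) = Hess v(·, Y)`.
  have h1 : ∀ v, 2 * coordHessian G (fun y => (φ y).re) x v (X x) -
      2 * coordHessian G (fun y => (φ y).im) x v (Y x) = 0 := fun v => by
    obtain ⟨a1, a2⟩ := hG.fderiv_inner_gradient hu hu hX hX v
    obtain ⟨b1, b2⟩ := hG.fderiv_inner_gradient hv hv hY hY v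
    have h := (a1.sub b1).unique (hre.congr_of_eventuallyEq (hκ.mono fun y hy => hy.1))
    have h' := congrArg (fun L : E →L[ℝ] ℝ => L v) h
    simp only [_root_.sub_apply, _root_.zero_apply, a2, b2] at h'
    linarith
  -- Derivative of the imaginary part: `Hess u(·, Y) = -Hess v(·, X)`. Evaluating both relations at
  -- `X` and `Y`, the mixed terms cancel by symmetry of the Hessian.
  have h2 : ∀ v, coordHessian G (fun y => (φ y).re) x v (Y x) +
      coordHessian G (fun y => (φ y).im) x v (X x) = 0 := fun v => by
    obtain ⟨a1, a2⟩ := hG.fderiv_inner_gradient hu hv hX hY v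
    have h := (a1.const_mul 2).unique (him.congr_of_eventuallyEq (hκ.mono fun y hy => hy.2))
    have h' := congrArg (fun L : E →L[ℝ] ℝ => L v) h
    simp only [_root_.smul_apply, _root_.zero_apply, a2, smul_eq_mul] at h'
    linarith
  have s1 := hG.coordHessian_symm hu (X x) (Y x)
  have s2 := hG.coordHessian_symm hv (X x) (Y x)
  constructor
  · linarith [h1 (X x), h2 (Y x)]
  · linarith [h1 (Y x), h2 (X x)]

end NormalHessian

/-! ### Functions vanishing along a map. -/

section ChainRule

variable {E : Type*} [NormedAddCommGroup E] [NormedSpace ℝ E]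
  {F : Type*} [NormedAddCommGroup F] [NormedSpace ℝ F] {f : F → E} {y : F} {u : E → ℝ}

theorem fderiv_apply_fderiv_eq_zero (hu : DifferentiableAt ℝ u (f y))
    (hf : DifferentiableAt ℝ f y) (h : u ∘ f =ᶠ[𝓝 y] fun _ => 0) (w : F) :
    fderiv ℝ u (f y) (fderiv ℝ f y w) = 0 := by
  have h1 := (hu.hasFDerivAt.comp y hf.hasFDerivAt).unique
    ((hasFDerivAt_const (0 : ℝ) y).congr_of_eventuallyEq h)
  exact congrArg (fun L : F →L[ℝ] ℝ => L w) h1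

/-- The second derivative of `u ∘ f = 0`. -/
theorem fderiv_fderiv_add_eq_zero (hu : ContDiffAt ℝ 2 u (f y)) (hf : ContDiffAt ℝ 2 f y)
    (h : u ∘ f =ᶠ[𝓝 y] fun _ => 0) (v w : F) :
    fderiv ℝ (fderiv ℝ u) (f y) (fderiv ℝ f y v) (fderiv ℝ f y w) +
      fderiv ℝ u (f y) (fderiv ℝ (fderiv ℝ f) y v w) = 0 := by
  -- The first-order relation holds on a neighbourhood, so it can be differentiated once more.
  have h1 : (fun y' => fderiv ℝ u (f y') (fderiv ℝ f y' w)) =ᶠ[𝓝 y] fun _ => 0 := by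
    filter_upwards [h.eventually_nhds, (hu.eventually (by simp)).filter_mono hf.continuousAt,
      hf.eventually (by simp)] with y' h1 h2 h3
    replace h2 : ContDiffAt ℝ 2 u (f y') := h2
    exact fderiv_apply_fderiv_eq_zero (h2.differentiableAt (by simp))
      (h3.differentiableAt (by simp)) h1 w
  have hu' : DifferentiableAt ℝ (fderiv ℝ u) (f y) :=
    (hu.fderiv_right (m := 1) (by norm_num)).differentiableAt (by simp)
  have hf' : DifferentiableAt ℝ (fderiv ℝ f) y :=
    (hf.fderiv_right (m := 1) (by norm_num)).differentiableAt (by simp)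
  have h2 := (hu'.hasFDerivAt.comp y (hf.differentiableAt (by simp)).hasFDerivAt).clm_apply
    (hf'.hasFDerivAt.clm_apply (hasFDerivAt_const w y))
  have h3 := h2.unique ((hasFDerivAt_const (0 : ℝ) y).congr_of_eventuallyEq h1)
  have h4 := congrArg (fun L : F →L[ℝ] ℝ => L v) h3
  simp at h4
  linarith

end ChainRule

/-! ### Vanishing of the mean curvature of a regular zero fibre. -/

section Minimality

variable {E : Type*} [NormedAddCommGroup E] [NormedSpace ℝ E] [FiniteDimensional ℝ E]
  {M : Type*} [TopologicalSpace M] [ChartedSpace E M] [IsManifold 𝓘(ℝ, E) ∞ M]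
  (g : Bundle.ContMDiffRiemannianMetric 𝓘(ℝ, E) ∞ E (fun p : M => TangentSpace 𝓘(ℝ, E) p))

/-- Where `κ(φ, φ) = 0`, the gradients of the real and imaginary parts are orthogonal and of equal
length. -/
theorem inner_gradient_of_conformality_eq_zero {φ : M → ℂ} {p : M}
    (h : conformality g φ φ p = 0) :
    g.inner p (gradient g (fun q => (φ q).re) p) (gradient g (fun q => (φ q).re) p) =
        g.inner p (gradient g (fun q => (φ q).im) p) (gradient g (fun q => (φ q).im) p) ∧
      g.inner p (gradient g (fun q => (φ q).re) p) (gradient g (fun q => (φ q).im) p) = 0 := by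
  have h1 := congrArg Complex.re h
  have h2 := congrArg Complex.im h
  simp only [conformality, complexMetric, complexGradient, Complex.zero_re, Complex.zero_im] at h1 h2
  rw [g.symm _ (gradient g (fun q => (φ q).im) p)] at h2
  exact ⟨by linarith, by linarith⟩

/-- Both gradients have the same length, so if one of them is non-zero then so is the real one. -/
theorem inner_gradient_self_pos {φ : M → ℂ} {p : M} (h : conformality g φ φ p = 0)
    (h0 : complexGradient g φ p ≠ 0) :
    0 < g.inner p (gradient g (fun q => (φ q).re) p) (gradient g (fun q => (φ q).re) p) := by
  by_cases hu : gradient g (fun q => (φ q).re) p = 0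
  · have hv : gradient g (fun q => (φ q).im) p ≠ 0 := fun hv => h0 (Prod.ext hu hv)
    rw [(inner_gradient_of_conformality_eq_zero g h).1]
    exact g.pos p _ hv
  · exact g.pos p _ hu

variable {k : ℕ} {S : Set M} {V : Set (EuclideanSpace ℝ (Fin k))}
  {f : EuclideanSpace ℝ (Fin k) → M} {y : EuclideanSpace ℝ (Fin k)}

theorem IsLocalParametrization.contDiffAt_paramInChart
    (hf : IsLocalParametrization (E := E) S V f) (hy : y ∈ V) :
    ContDiffAt ℝ ∞ (paramInChart (E := E) f y) y := by
  rw [← contMDiffAt_iff_contDiffAt]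
  exact (contMDiffAt_extChartAt (I := 𝓘(ℝ, E)) (x := f y)).comp y
    (hf.contMDiffOn.contMDiffAt (hf.isOpen.mem_nhds hy))

/-- The parametrisation read in the chart has injective derivative, as a composite of an immersion
and a chart; the `∂_i f` are the images of the standard basis. -/
theorem IsLocalParametrization.linearIndependent_coordTangent
    (hf : IsLocalParametrization (E := E) S V f) (hy : y ∈ V) :
    LinearIndependent ℝ (coordTangent (E := E) f y) := by
  have : IsManifold 𝓘(ℝ, E) 1 M := .of_le (n := ∞) (by simp)
  have hinj : Function.Injective (fderiv ℝ (paramInChart (E := E) f y) y) := by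
    have h := mfderiv_comp y (mdifferentiableAt_atlas (I := 𝓘(ℝ, E))
      (chart_mem_atlas E (f y)) (mem_chart_source E (f y)))
      ((hf.contMDiffOn.contMDiffAt (hf.isOpen.mem_nhds hy)).mdifferentiableAt (by simp))
    rw [mfderiv_eq_fderiv] at h
    have h1 : Function.Injective (mfderiv 𝓘(ℝ, E) 𝓘(ℝ, E) (chartAt E (f y)) (f y)) :=
      (mdifferentiable_chart (I := 𝓘(ℝ, E)) (f y)).mfderiv_injective (mem_chart_source E (f y))
    have h2 := h1.comp (hf.injective_mfderiv y hy)
    intro a b hab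
    refine h2 ?_
    have h3 : ∀ c, fderiv ℝ (paramInChart (E := E) f y) y c =
        mfderiv 𝓘(ℝ, E) 𝓘(ℝ, E) (chartAt E (f y)) (f y)
          (mfderiv 𝓘(ℝ, EuclideanSpace ℝ (Fin k)) 𝓘(ℝ, E) f y c) := fun c =>
      congrArg (fun L : EuclideanSpace ℝ (Fin k) →L[ℝ] E => L c) h
    exact ((h3 a).symm.trans hab).trans (h3 b)
  have hb := (EuclideanSpace.basisFun (Fin k) ℝ).toBasis.linearIndependent.map'
    (fderiv ℝ (paramInChart (E := E) f y) y : EuclideanSpace ℝ (Fin k) →ₗ[ℝ] E)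
    (LinearMap.ker_eq_bot.2 hinj)
  have heq : coordTangent (E := E) f y = ⇑(fderiv ℝ (paramInChart (E := E) f y) y :
      EuclideanSpace ℝ (Fin k) →ₗ[ℝ] E) ∘ ⇑(EuclideanSpace.basisFun (Fin k) ℝ).toBasis := by
    funext i
    simp [coordTangent]
  rw [heq]
  exact hb

/-- The mean curvature of the regular zero set of an eigenfunction vanishes. -/
theorem IsEigenfunction.meanCurvature_eq_zero {φ : M → ℂ} (hφ : IsEigenfunction g φ)
    (hgrad : ∀ p ∈ φ ⁻¹' {0}, complexGradient g φ p ≠ 0)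
    (hk : k + 2 = Module.finrank ℝ E) (hf : IsLocalParametrization (E := E) (φ ⁻¹' {0}) V f)
    (hy : y ∈ V) : meanCurvature g f y = 0 := by
  obtain ⟨hsm, lam, μ, heig⟩ := hφ
  obtain ⟨U, -, hU⟩ := hf.image_eq
  have hfz : ∀ y' ∈ V, φ (f y') = 0 := fun y' hy' =>
    (hU.subset (Set.mem_image_of_mem f hy')).1
  set p := f y with hp
  set x := chartAt E p p with hx
  have hxt : x ∈ (chartAt E p).target := (chartAt E p).map_source (mem_chart_source E p)
  have hψ : (chartAt E p).symm x = p := (chartAt E p).left_inv (mem_chart_source E p)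
  set G := metricInChart g p
  have hG : IsMetricNear G x := isMetricNear_metricInChart g p
  have hure := contMDiff_re hsm
  have huim := contMDiff_im hsm
  set X := vectorFieldInChart p (gradient g fun q => (φ q).re)
  set Y := vectorFieldInChart p (gradient g fun q => (φ q).im)
  set φ' := φ ∘ (chartAt E p).symm with hφ'
  have hX : IsGradientNear G (fun z => (φ' z).re) X x := isGradientNear_gradient g hure p
  have hY : IsGradientNear G (fun z => (φ' z).im) Y x := isGradientNear_gradient g huim p
  have hcd : ContDiffAt ℝ 2 φ' x :=
    (contDiffAt_comp_chartAt_symm hsm p hxt).of_le (WithTop.coe_le_coe.2 le_top)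
  have hu2 : ContDiffAt ℝ 2 (fun y => (φ' y).re) x := Complex.reCLM.contDiff.contDiffAt.comp x hcd
  have hv2 : ContDiffAt ℝ 2 (fun y => (φ' y).im) x := Complex.imCLM.contDiff.contDiffAt.comp x hcd
  have hp0 : φ p = 0 := hfz y hy
  have h0 : φ' x = 0 := by rw [hφ', Function.comp_apply, hψ, hp0]
  have hκ : ∀ᶠ z in 𝓝 x, G z (X z) (X z) - G z (Y z) (Y z) = (μ * φ' z ^ 2).re ∧
      2 * G z (X z) (Y z) = (μ * φ' z ^ 2).im := by
    filter_upwards [eventually_mem_chartAt_target p] with z hz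
    have h1 := (conformality_eq g φ p hz).symm.trans (heig _).2
    exact ⟨congrArg Complex.re h1, congrArg Complex.im h1⟩
  have hnormal := hG.coordHessian_add_eq_zero hcd hX hY h0 hκ
  -- the tangent vectors
  set F := paramInChart (E := E) f y with hF
  have hF2 : ContDiffAt ℝ 2 F y :=
    (hf.contDiffAt_paramInChart hy).of_le (WithTop.coe_le_coe.2 le_top)
  set t := coordTangent (E := E) f y with ht
  have hli : LinearIndependent ℝ t := hf.linearIndependent_coordTangent hy
  have hzero : φ' ∘ F =ᶠ[𝓝 y] fun _ => 0 := by
    have hc : ContinuousAt f y :=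
      (hf.contMDiffOn.contMDiffAt (hf.isOpen.mem_nhds hy)).continuousAt
    filter_upwards [hf.isOpen.mem_nhds hy, hc.preimage_mem_nhds
      ((chartAt E p).open_source.mem_nhds (mem_chart_source E p))] with y' h1 h2
    show φ ((chartAt E p).symm (chartAt E p (f y'))) = 0
    rw [(chartAt E p).left_inv h2, hfz y' h1]
  have hzre : (fun z => (φ' z).re) ∘ F =ᶠ[𝓝 y] fun _ => 0 := by
    filter_upwards [hzero] with y' h1
    exact congrArg Complex.re h1
  have hzim : (fun z => (φ' z).im) ∘ F =ᶠ[𝓝 y] fun _ => 0 := by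
    filter_upwards [hzero] with y' h1
    exact congrArg Complex.im h1
  -- orthogonality relations
  have hsymm : ∀ v w, G x v w = G x w v := metricInChart_symm g p x
  have hpos : ∀ v, v ≠ 0 → 0 < G x v v := fun v hv => metricInChart_pos g p hxt hv
  have hXg := hX.self_of_nhds
  have hYg := hY.self_of_nhds
  have hconf : conformality g φ φ p = 0 := by rw [(heig p).2, hp0]; simp
  obtain ⟨hXX, hXY⟩ := inner_gradient_of_conformality_eq_zero g hconf
  have hρ := inner_gradient_self_pos g hconf (hgrad p hp0)
  rw [← hψ] at hXX hXY hρ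
  rw [← metricInChart_vectorField g p hxt] at hXY hρ
  rw [← metricInChart_vectorField g p hxt, ← metricInChart_vectorField g p hxt] at hXX
  change G x (X x) (X x) = G x (Y x) (Y x) at hXX
  change G x (X x) (Y x) = 0 at hXY
  change 0 < G x (X x) (X x) at hρ
  have htX : ∀ i, G x (X x) (t i) = 0 := fun i => by
    rw [hXg]
    exact fderiv_apply_fderiv_eq_zero (f := F) (hu2.differentiableAt (by simp))
      (hF2.differentiableAt (by simp)) hzre _
  have htY : ∀ i, G x (Y x) (t i) = 0 := fun i => by
    rw [hYg]
    exact fderiv_apply_fderiv_eq_zero (f := F) (hv2.differentiableAt (by simp))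
      (hF2.differentiableAt (by simp)) hzim _
  -- From `u ∘ f = 0` one gets `du(∂_i ∂_j f) = -D²u(t_i, t_j)`; the Christoffel term completes this
  -- to the Hessian. Used for both `u = Re φ` and `u = Im φ`.
  have hcov : ∀ {u : E → ℝ} {Z : E → E}, ContDiffAt ℝ 2 u x → IsGradientNear G u Z x →
      u ∘ F =ᶠ[𝓝 y] (fun _ => 0) → ∀ i j,
      G x (coordCovDeriv g f y i j) (Z x) = - coordHessian G u x (t i) (t j) := by
    intro u Z hu hZ hz i j
    have h1 := fderiv_fderiv_add_eq_zero (f := F) hu hF2 hz (EuclideanSpace.single i 1)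
      (EuclideanSpace.single j 1)
    have h2 : coordCovDeriv g f y i j =
      fderiv ℝ (fderiv ℝ F) y (EuclideanSpace.single i 1) (EuclideanSpace.single j 1) +
        coordChristoffel G x (t j) (t i) := rfl
    rw [hsymm, hZ.self_of_nhds, h2, map_add, coordHessian]
    have h3 : fderiv ℝ (fderiv ℝ u) x (t i) (t j) +
      fderiv ℝ u x (fderiv ℝ (fderiv ℝ F) y (EuclideanSpace.single i 1)
        (EuclideanSpace.single j 1)) = 0 := h1
    linarith
  -- The Laplacian is the tangential trace of the Hessian plus its trace on the normal plane divided
  -- by `|X|²`; if the full trace and the normal one vanish, so does the tangential one.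
  have htr : ∀ {u : E → ℝ} {Z : E → E}, ContDiffAt ℝ 2 u x → IsGradientNear G u Z x →
      LinearMap.trace ℝ E (fderiv ℝ Z x + coordChristoffel G x (Z x) : E →L[ℝ] E) = 0 →
      coordHessian G u x (X x) (X x) + coordHessian G u x (Y x) (Y x) = 0 →
      ∑ i, ∑ j, (Matrix.of fun i j => G x (t i) (t j))⁻¹ i j * coordHessian G u x (t i) (t j) = 0 := by
    intro u Z hu hZ h1 h2
    rw [trace_eq_sum_frame hsymm hpos hli hk hρ.ne' rfl hXX.symm hXY htX htY] at h1
    simp only [_root_.add_apply, hG.apply_covDeriv_gradient hu hZ, h2, zero_div, add_zero] at h1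
    rw [← h1]
    refine Finset.sum_congr rfl fun i _ => Finset.sum_congr rfl fun j _ => ?_
    rw [hG.coordHessian_symm hu]
  have hτ : tension g φ p = 0 := by rw [(heig p).1, hp0, mul_zero]
  have sX := htr hu2 hX (congrArg Complex.re hτ) hnormal.1
  have sY := htr hv2 hY (congrArg Complex.im hτ) hnormal.2
  -- the mean curvature is orthogonal to everything
  have hff : firstFundamentalForm (E := E) g f y = Matrix.of fun i j => G x (t i) (t j) := rfl
  have hnp : ∀ v l, G x (normalPart g f y v) (t l) = 0 := fun v l => by
    have h1 : normalPart g f y v = v - ∑ i, ∑ j,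
      ((Matrix.of fun i j => G x (t i) (t j))⁻¹ i j * G x v (t i)) • t j := rfl
    rw [h1, map_sub, _root_.sub_apply, sum_gram_inv_mul hpos hli, sub_self]
  -- Against a normal vector the tangential correction in `normalPart` is invisible.
  have hnp' : ∀ v z, (∀ i, G x z (t i) = 0) → G x (normalPart g f y v) z = G x v z := by
    intro v z hz
    have h1 : normalPart g f y v = v - ∑ i, ∑ j,
      ((Matrix.of fun i j => G x (t i) (t j))⁻¹ i j * G x v (t i)) • t j := rfl
    rw [h1, map_sub, _root_.sub_apply, sub_eq_self]
    simp only [map_sum, _root_.sum_apply, map_smul, _root_.smul_apply, hsymm _ z, hz, smul_zero,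
      Finset.sum_const_zero]
  have hH : ∀ z, G x (meanCurvature g f y) z = (1 / (k : ℝ)) * ∑ i, ∑ j,
      (Matrix.of fun i j => G x (t i) (t j))⁻¹ i j *
        G x (normalPart g f y (coordCovDeriv g f y i j)) z := fun z => by
    rw [meanCurvature, hff]
    simp only [map_sum, _root_.sum_apply, map_smul, _root_.smul_apply, smul_eq_mul,
      secondFundamentalForm]
  refine eq_zero_of_orthogonal hpos hli hk hρ.ne' rfl hXX.symm hXY (by rw [hsymm, hXY]) htX htY
    (fun l => ?_) ?_ ?_
  · simp [hH, hnp]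
  · simp only [hH, hnp' _ _ htX, hcov hu2 hX hzre, mul_neg, Finset.sum_neg_distrib, sX, neg_zero,
      mul_zero]
  · simp only [hH, hnp' _ _ htY, hcov hv2 hY hzim, mul_neg, Finset.sum_neg_distrib, sY, neg_zero,
      mul_zero]

end Minimality

/-! ### Regular zero sets as submanifolds. -/

section RegularValue

variable {E : Type*} [NormedAddCommGroup E] [NormedSpace ℝ E] [FiniteDimensional ℝ E]
  {F : Type*} [NormedAddCommGroup F] [NormedSpace ℝ F] [FiniteDimensional ℝ F]
  {M : Type*} [TopologicalSpace M] [ChartedSpace E M] [IsManifold 𝓘(ℝ, E) ∞ M]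

/-- A surjective linear map onto `F` can be completed to an isomorphism `E ≃ F × ℝ^k`. -/
theorem exists_isInvertible_prod {A : E →L[ℝ] F} (hA : Function.Surjective A) {k : ℕ}
    (hk : k + Module.finrank ℝ F = Module.finrank ℝ E) :
    ∃ P : E →L[ℝ] EuclideanSpace ℝ (Fin k), (A.prod P).IsInvertible := by
  have hker : Module.finrank ℝ A.ker = k := by
    have h1 := LinearMap.finrank_range_add_finrank_ker (A : E →ₗ[ℝ] F)
    rw [LinearMap.range_eq_top.2 hA, finrank_top] at h1
    have h2 : Module.finrank ℝ A.ker = Module.finrank ℝ (A : E →ₗ[ℝ] F).ker := rfl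
    omega
  -- `P` is a projection onto the kernel of `A`: a vector killed by both `A` and `P` lies in the
  -- kernel, where `P` is the identity.
  obtain ⟨P, hP⟩ := Submodule.ClosedComplemented.of_finiteDimensional_quotient (𝕜 := ℝ)
    (p := A.ker) A.isClosed_ker
  let L : A.ker ≃L[ℝ] EuclideanSpace ℝ (Fin k) :=
    ContinuousLinearEquiv.ofFinrankEq (by simp [hker])
  refine ⟨(L : A.ker →L[ℝ] EuclideanSpace ℝ (Fin k)) ∘L P, ?_⟩
  have hinj : Function.Injective
      (A.prod ((L : A.ker →L[ℝ] EuclideanSpace ℝ (Fin k)) ∘L P)) := by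
    refine (injective_iff_map_eq_zero _).2 fun v hv => ?_
    have h1 : A v = 0 := congrArg Prod.fst hv
    have h2 : L (P v) = 0 := congrArg Prod.snd hv
    have h3 := hP ⟨v, h1⟩
    rw [L.map_eq_zero_iff] at h2
    exact congrArg Subtype.val (h3.symm.trans h2)
  have hdim : Module.finrank ℝ E = Module.finrank ℝ (F × EuclideanSpace ℝ (Fin k)) := by
    rw [Module.finrank_prod, finrank_euclideanSpace_fin, ← hk, add_comm]
  exact ⟨(LinearEquiv.ofInjectiveOfFinrankEq
    (A.prod ((L : A.ker →L[ℝ] EuclideanSpace ℝ (Fin k)) ∘L P) : E →ₗ[ℝ] _) hinj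
    hdim).toContinuousLinearEquiv, rfl⟩

/-- Around a regular point, a smooth map is part of a smooth coordinate system. -/
theorem exists_openPartialHomeomorph_of_surjective_mfderiv {φ : M → F}
    (hφ : ContMDiff 𝓘(ℝ, E) 𝓘(ℝ, F) ∞ φ) {p : M}
    (hp : Function.Surjective (mfderiv 𝓘(ℝ, E) 𝓘(ℝ, F) φ p)) {k : ℕ}
    (hk : k + Module.finrank ℝ F = Module.finrank ℝ E) :
    ∃ (Θ : OpenPartialHomeomorph M (F × EuclideanSpace ℝ (Fin k))), p ∈ Θ.source ∧
      (∀ q ∈ Θ.source, (Θ q).1 = φ q) ∧ (∀ q ∈ Θ.source, MDifferentiableAt 𝓘(ℝ, E)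
        𝓘(ℝ, EuclideanSpace ℝ (Fin k)) (fun q => (Θ q).2) q) ∧
      ContMDiffOn 𝓘(ℝ, F × EuclideanSpace ℝ (Fin k)) 𝓘(ℝ, E) ∞ Θ.symm Θ.target := by
  have : IsManifold 𝓘(ℝ, E) 1 M := .of_le (n := ∞) (by simp)
  set x := chartAt E p p with hx
  have hxt : x ∈ (chartAt E p).target := (chartAt E p).map_source (mem_chart_source E p)
  have hψ : (chartAt E p).symm x = p := (chartAt E p).left_inv (mem_chart_source E p)
  set h : E → F := φ ∘ (chartAt E p).symm with hh
  have hsm : ∀ z ∈ (chartAt E p).target, ContDiffAt ℝ ∞ h z := fun z hz =>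
    contDiffAt_comp_chartAt_symm hφ p hz
  have hA : Function.Surjective (fderiv ℝ h x) := fun c => by
    rw [← hψ] at hp
    obtain ⟨v, hv⟩ := hp c
    refine ⟨mfderiv 𝓘(ℝ, E) 𝓘(ℝ, E) (chartAt E p) ((chartAt E p).symm x) v, ?_⟩
    refine (fderiv_comp_chartAt_symm hφ p hxt _).trans ?_
    rw [mfderiv_chartAt_symm_mfderiv p hxt]
    exact hv
  obtain ⟨P, hP⟩ := exists_isInvertible_prod hA hk
  set Ψ : E → F × EuclideanSpace ℝ (Fin k) := fun z => (h z, P z) with hΨ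
  have hΨsm : ∀ z ∈ (chartAt E p).target, ContDiffAt ℝ ∞ Ψ z := fun z hz =>
    (hsm z hz).prodMk P.contDiff.contDiffAt
  obtain ⟨D, hD⟩ := hP
  have hΨD : HasFDerivAt Ψ (D : E →L[ℝ] F × EuclideanSpace ℝ (Fin k)) x := by
    rw [hD]
    exact ((hsm x hxt).differentiableAt (by simp)).hasFDerivAt.prodMk P.hasFDerivAt
  set e := (hΨsm x hxt).toOpenPartialHomeomorph Ψ hΨD (by simp) with he
  have hex : x ∈ e.source := (hΨsm x hxt).mem_toOpenPartialHomeomorph_source hΨD (by simp)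
  -- The inverse function theorem controls the inverse only at the base point. Shrinking to the open
  -- set where `Ψ` is smooth with invertible derivative makes the inverse smooth throughout.
  set O : Set E := (chartAt E p).target ∩ fderiv ℝ Ψ ⁻¹'
    Set.range ((↑) : (E ≃L[ℝ] F × EuclideanSpace ℝ (Fin k)) → E →L[ℝ] _) with hO
  have hOopen : IsOpen O := by
    have hc : ContDiffOn ℝ ∞ Ψ (chartAt E p).target := fun z hz => (hΨsm z hz).contDiffWithinAt
    exact (hc.continuousOn_fderiv_of_isOpen (chartAt E p).open_target
      (by simp)).isOpen_inter_preimage (chartAt E p).open_target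
      (ContinuousLinearEquiv.isOpen (𝕜 := ℝ))
  have hxO : x ∈ O := ⟨hxt, D, hΨD.fderiv.symm⟩
  refine ⟨(chartAt E p).trans (e.restrOpen O hOopen), ?_, ?_, ?_, ?_⟩
  · rw [OpenPartialHomeomorph.trans_source]
    exact ⟨mem_chart_source E p, by rw [Set.mem_preimage, e.restrOpen_source]; exact ⟨hex, hxO⟩⟩
  · intro q hq
    show φ ((chartAt E p).symm (chartAt E p q)) = φ q
    rw [(chartAt E p).left_inv hq.1]
  · intro q hq
    exact P.differentiable.mdifferentiable.mdifferentiableAt.comp q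
      (mdifferentiableAt_atlas (I := 𝓘(ℝ, E)) (chart_mem_atlas E p) hq.1)
  · intro z hz
    rw [OpenPartialHomeomorph.trans_target] at hz
    have hz1 : z ∈ e.target := hz.1.1
    have hz2 : e.symm z ∈ O := hz.1.2
    obtain ⟨D', hD'⟩ := hz2.2
    have h1 : ContDiffAt ℝ ∞ e.symm z := by
      refine e.contDiffAt_symm (f₀' := D') hz1 ?_ (hΨsm _ hz2.1)
      rw [hD']
      exact ((hΨsm _ hz2.1).differentiableAt (by simp)).hasFDerivAt
    have h2 : ContMDiffAt 𝓘(ℝ, E) 𝓘(ℝ, E) ∞ (chartAt E p).symm (e.symm z) :=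
      contMDiffOn_chart_symm.contMDiffAt ((chartAt E p).open_target.mem_nhds hz2.1)
    exact (h2.comp z h1.contMDiffAt).contMDiffWithinAt

/-- The zero set of a smooth map with surjective derivative along it is a submanifold. -/
theorem isSubmanifold_preimage_zero {φ : M → F} (hφ : ContMDiff 𝓘(ℝ, E) 𝓘(ℝ, F) ∞ φ)
    (hsurj : ∀ p ∈ φ ⁻¹' {0}, Function.Surjective (mfderiv 𝓘(ℝ, E) 𝓘(ℝ, F) φ p)) {k : ℕ}
    (hk : k + Module.finrank ℝ F = Module.finrank ℝ E) :
    IsSubmanifold (E := E) (φ ⁻¹' {0}) k := by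
  intro p hp
  obtain ⟨Θ, hpΘ, hΘφ, hΘd, hΘs⟩ :=
    exists_openPartialHomeomorph_of_surjective_mfderiv hφ (hsurj p hp) hk
  have hcont : Continuous fun y : EuclideanSpace ℝ (Fin k) => ((0 : F), y) := by fun_prop
  set V : Set (EuclideanSpace ℝ (Fin k)) := {y | ((0 : F), y) ∈ Θ.target} with hV
  have hVopen : IsOpen V := Θ.open_target.preimage hcont
  -- The parametrisation is the slice `{0} × ℝ^k` of the adapted coordinates; the second coordinate
  -- of `Θ` is a smooth left inverse, giving both the immersion and the embedding property.
  set f : EuclideanSpace ℝ (Fin k) → M := fun y => Θ.symm (0, y) with hf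
  have hfs : ∀ y ∈ V, f y ∈ Θ.source := fun y hy => Θ.map_target hy
  have hΘf : ∀ y ∈ V, Θ (f y) = (0, y) := fun y hy => Θ.right_inv hy
  have hfsm : ContMDiffOn 𝓘(ℝ, EuclideanSpace ℝ (Fin k)) 𝓘(ℝ, E) ∞ f V :=
    hΘs.comp (contDiff_const.prodMk contDiff_id).contMDiff.contMDiffOn fun y hy => hy
  have himage : f '' V = φ ⁻¹' {0} ∩ Θ.source := by
    ext q
    constructor
    · rintro ⟨y, hy, rfl⟩
      refine ⟨?_, hfs y hy⟩
      rw [Set.mem_preimage, ← hΘφ _ (hfs y hy), hΘf y hy, Set.mem_singleton_iff]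
    · rintro ⟨hq, hqs⟩
      have h1 : ((0 : F), (Θ q).2) = Θ q := Prod.ext ((hΘφ q hqs).trans hq).symm rfl
      refine ⟨(Θ q).2, ?_, ?_⟩
      · rw [hV, Set.mem_ofPred_eq, h1]
        exact Θ.map_source hqs
      · simp only [hf, h1, Θ.left_inv hqs]
  refine ⟨V, f, ⟨hVopen, hfsm, fun y hy => ?_, ?_, Θ.source, Θ.open_source, himage⟩,
    himage ▸ ⟨hp, hpΘ⟩⟩
  · have h1 := mfderiv_comp y (hΘd _ (hfs y hy))
      ((hfsm.contMDiffAt (hVopen.mem_nhds hy)).mdifferentiableAt (by simp))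
    have h2 : (fun q => (Θ q).2) ∘ f =ᶠ[𝓝 y] id := by
      filter_upwards [hVopen.mem_nhds hy] with y' hy'
      simp [hΘf y' hy']
    rw [h2.mfderiv_eq, mfderiv_id] at h1
    have h3 : ∀ v, v = mfderiv 𝓘(ℝ, E) 𝓘(ℝ, EuclideanSpace ℝ (Fin k)) (fun q => (Θ q).2) (f y)
        (mfderiv 𝓘(ℝ, EuclideanSpace ℝ (Fin k)) 𝓘(ℝ, E) f y v) := fun v =>
      congrArg (fun L : EuclideanSpace ℝ (Fin k) →L[ℝ] EuclideanSpace ℝ (Fin k) => L v) h1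
    intro a b hab
    rw [h3 a, h3 b, hab]
  · have h1 : Continuous fun y : V => (⟨f y, hfs y y.2⟩ : Θ.source) :=
      (hfsm.continuousOn.domRestrict).subtype_mk _
    have h2 : Continuous fun q : Θ.source => (Θ q).2 :=
      continuous_snd.comp Θ.continuousOn.domRestrict
    have h3 : Topology.IsEmbedding ((fun q : Θ.source => (Θ q).2) ∘
        fun y : V => (⟨f y, hfs y y.2⟩ : Θ.source)) := by
      convert (Topology.IsEmbedding.subtypeVal (p := fun y => y ∈ V)) using 1
      funext y
      simp [hΘf y y.2]
    exact Topology.IsEmbedding.subtypeVal.comp (.of_comp h1 h2 h3)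

end RegularValue

/-! ### Regular zero fibres of eigenfunctions are minimal. -/

section EigenfunctionFibre

variable {E : Type*} [NormedAddCommGroup E] [NormedSpace ℝ E] [FiniteDimensional ℝ E]
  {M : Type*} [TopologicalSpace M] [ChartedSpace E M] [IsManifold 𝓘(ℝ, E) ∞ M]
  (g : Bundle.ContMDiffRiemannianMetric 𝓘(ℝ, E) ∞ E (fun p : M => TangentSpace 𝓘(ℝ, E) p))

/-- With `X`, `Y` the orthogonal gradients of equal length, `dφ(αX + βY) = (α + iβ) |X|²`. -/
theorem surjective_mfderiv_of_conformality_eq_zero {φ : M → ℂ}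
    (hφ : ContMDiff 𝓘(ℝ, E) 𝓘(ℝ, ℂ) ∞ φ) {p : M} (h : conformality g φ φ p = 0)
    (h0 : complexGradient g φ p ≠ 0) :
    Function.Surjective (mfderiv 𝓘(ℝ, E) 𝓘(ℝ, ℂ) φ p) := by
  obtain ⟨h1, h2⟩ := inner_gradient_of_conformality_eq_zero g h
  have hρ := inner_gradient_self_pos g h h0
  have hd : MDifferentiableAt 𝓘(ℝ, E) 𝓘(ℝ, ℂ) φ p := hφ.mdifferentiable (by simp) p
  have hre : ∀ v, (mfderiv 𝓘(ℝ, E) 𝓘(ℝ, ℂ) φ p v : ℂ).re =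
      g.inner p (gradient g (fun q => (φ q).re) p) v := fun v => by
    rw [inner_gradient]
    have h := mfderiv_comp p Complex.reCLM.differentiableAt.mdifferentiableAt hd
    rw [mfderiv_eq_fderiv, Complex.reCLM.fderiv] at h
    exact (congrArg (fun L : E →L[ℝ] ℝ => L v) h).symm
  have him : ∀ v, (mfderiv 𝓘(ℝ, E) 𝓘(ℝ, ℂ) φ p v : ℂ).im =
      g.inner p (gradient g (fun q => (φ q).im) p) v := fun v => by
    rw [inner_gradient]
    have h := mfderiv_comp p Complex.imCLM.differentiableAt.mdifferentiableAt hd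
    rw [mfderiv_eq_fderiv, Complex.imCLM.fderiv] at h
    exact (congrArg (fun L : E →L[ℝ] ℝ => L v) h).symm
  set X := gradient g (fun q => (φ q).re) p
  set Y := gradient g (fun q => (φ q).im) p
  have h3 : g.inner p Y X = 0 := by rw [g.symm, h2]
  intro c
  refine ⟨((c : ℂ).re / g.inner p X X) • X + ((c : ℂ).im / g.inner p X X) • Y,
    Complex.ext ?_ ?_⟩
  · rw [hre]
    simp only [map_add, map_smul, smul_eq_mul, h2, mul_zero, add_zero]
    exact div_mul_cancel₀ _ hρ.ne'
  · rw [him]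
    simp only [map_add, map_smul, smul_eq_mul, h3, mul_zero, zero_add, ← h1]
    exact div_mul_cancel₀ _ hρ.ne'

/-- The regular zero set of an eigenfunction is a minimal submanifold of codimension two. -/
theorem IsEigenfunction.isMinimalSubmanifold {φ : M → ℂ} (hφ : IsEigenfunction g φ)
    (hgrad : ∀ p ∈ φ ⁻¹' {0}, complexGradient g φ p ≠ 0) {k : ℕ}
    (hk : k + 2 = Module.finrank ℝ E) : IsMinimalSubmanifold g (φ ⁻¹' {0}) 2 := by
  refine ⟨k, hk, isSubmanifold_preimage_zero hφ.1 (fun p hp => ?_) (by simpa using hk),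
    fun V f hf y hy => hφ.meanCurvature_eq_zero g hgrad hk hf hy⟩
  obtain ⟨-, lam, μ, heig⟩ := id hφ
  refine surjective_mfderiv_of_conformality_eq_zero g hφ.1 ?_ (hgrad p hp)
  rw [(heig p).2, show φ p = 0 from hp]
  simp

end EigenfunctionFibre

end RiemannianGeometry

/-! ### The Fubini–Study metric and its connection in affine charts. -/

namespace CProj

open Filter Topology RiemannianGeometry

variable {m : ℕ}

/-- `liftDir` as a linear map. -/
def liftDirL (k : Fin (m + 1)) :
    EuclideanSpace ℂ (Fin m) →L[ℂ] EuclideanSpace ℂ (Fin (m + 1)) :=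
  LinearMap.toContinuousLinearMap
    { toFun := liftDir k
      map_add' := liftDir_add k
      map_smul' := liftDir_smul k }

@[simp] theorem liftDirL_apply (k : Fin (m + 1)) (v : EuclideanSpace ℂ (Fin m)) :
    liftDirL k v = liftDir k v := rfl

/-- The linear map which omits the `k`-th coordinate. -/
def omitCoord (k : Fin (m + 1)) :
    EuclideanSpace ℂ (Fin (m + 1)) →L[ℂ] EuclideanSpace ℂ (Fin m) :=
  LinearMap.toContinuousLinearMap
    { toFun := fun z => WithLp.toLp 2 fun j => z (k.succAbove j)
      map_add' := fun _ _ => rfl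
      map_smul' := fun _ _ => rfl }

@[simp] theorem omitCoord_apply (k : Fin (m + 1)) (z : EuclideanSpace ℂ (Fin (m + 1)))
    (j : Fin m) : omitCoord k z j = z (k.succAbove j) := rfl

theorem lift_add (k : Fin (m + 1)) (w v : EuclideanSpace ℂ (Fin m)) :
    lift k (w + v) = lift k w + liftDir k v := by
  ext i
  rcases Fin.eq_self_or_eq_succAbove k i with rfl | ⟨j, rfl⟩ <;> simp

theorem hasFDerivAt_lift (k : Fin (m + 1)) (w : EuclideanSpace ℂ (Fin m)) :
    HasFDerivAt (lift k) ((liftDirL k).restrictScalars ℝ) w := by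
  have h : lift k = fun v => lift k 0 + (liftDirL k).restrictScalars ℝ v := by
    funext v
    simp [← lift_add]
  rw [h]
  exact ((liftDirL k).restrictScalars ℝ).hasFDerivAt.const_add _

/-- The chart vector `omitCoord k y - y k • w` is the image of `y` under the projection `dπ` at
`lift k w`: its lift differs from `y` only by a multiple of the base vector, which is vertical. -/
theorem liftDir_omitCoord_sub (k : Fin (m + 1)) (w : EuclideanSpace ℂ (Fin m))
    (y : EuclideanSpace ℂ (Fin (m + 1))) :
    liftDir k (omitCoord k y - y k • w) = y + (-y k) • lift k w := by
  ext i
  rcases Fin.eq_self_or_eq_succAbove k i with rfl | ⟨j, rfl⟩ <;> simp [sub_eq_add_neg]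

/-- In the preferred chart at `p`, the Fubini–Study metric is given by its local expression. -/
theorem metricInChart_fubiniStudy (p : CProj m) (x : EuclideanSpace ℂ (Fin m)) :
    metricInChart (fubiniStudy m) p x = fsLocal (chartIndex p) x := by
  have : IsManifold 𝓘(ℝ, EuclideanSpace ℂ (Fin m)) 1 (CProj m) := .of_le (n := ∞) (by simp)
  ext v u
  rw [metricInChart_apply]
  set q := (chartAt (EuclideanSpace ℂ (Fin m)) p).symm x with hq
  -- Tangent vectors at `q` are read in the preferred chart of `q`, so this derivative is that of an
  -- affine coordinate change, under which the metric is invariant.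
  have hD := (mdifferentiableAt_atlas_symm (I := 𝓘(ℝ, EuclideanSpace ℂ (Fin m)))
    (chart_mem_atlas (EuclideanSpace ℂ (Fin m)) p) (x := x) trivial).hasMFDerivAt.2
  simp only [mfld_simps, writtenInExtChartAt] at hD
  replace hD := hasFDerivWithinAt_univ.1 hD
  have hw : lift (chartIndex p) x (chartIndex q) ≠ 0 :=
    (mem_affineChart_source (chartIndex q) (lift_ne_zero (chartIndex p) x)).1
      (mem_chart_source (EuclideanSpace ℂ (Fin m)) q)
  exact fsLocal_transition (chartIndex p) (chartIndex q) hw hD v u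

theorem inner_horizontal {z : EuclideanSpace ℂ (Fin (m + 1))} (hz : z ≠ 0)
    (a b : EuclideanSpace ℂ (Fin (m + 1))) :
    inner ℂ (horizontal z a) (horizontal z b) =
      inner ℂ a b - inner ℂ a z * inner ℂ z b / (‖z‖ ^ 2 : ℝ) := by
  have h1 : inner ℂ z z = ((‖z‖ ^ 2 : ℝ) : ℂ) := by
    rw [inner_self_eq_norm_sq_to_K]
    norm_cast
  have h2 : ((‖z‖ ^ 2 : ℝ) : ℂ) ≠ 0 := by
    rw [← h1]
    exact inner_self_ne_zero.2 hz
  simp only [horizontal, inner_sub_left, inner_sub_right, inner_smul_left, inner_smul_right, h1,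
    map_div₀, Complex.conj_ofReal, inner_conj_symm]
  field_simp
  ring

theorem hopfForm_eq {z : EuclideanSpace ℂ (Fin (m + 1))} (hz : z ≠ 0)
    (a b : EuclideanSpace ℂ (Fin (m + 1))) :
    hopfForm z a b = (inner ℂ a b).re / ‖z‖ ^ 2 -
      (inner ℂ a z * inner ℂ z b).re / (‖z‖ ^ 2) ^ 2 := by
  have h2 : ‖z‖ ^ 2 ≠ 0 := pow_ne_zero 2 (norm_ne_zero_iff.2 hz)
  rw [hopfForm, inner_horizontal hz, Complex.sub_re, Complex.div_ofReal_re]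
  field_simp

theorem inner_liftDir_liftDir (k : Fin (m + 1)) (w v : EuclideanSpace ℂ (Fin m)) :
    inner ℂ (liftDir k w) (liftDir k v) = inner ℂ w v := by
  rw [PiLp.inner_apply, PiLp.inner_apply, Fin.sum_univ_succAbove _ k]
  simp

theorem fsLocal_eq (k : Fin (m + 1)) (w v u : EuclideanSpace ℂ (Fin m)) :
    fsLocal k w v u = (inner ℂ v u).re / (1 + ‖w‖ ^ 2) -
      (inner ℂ v w * inner ℂ w u).re / (1 + ‖w‖ ^ 2) ^ 2 := by
  have h : inner ℂ (liftDir k v) (lift k w) = inner ℂ v w := by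
    rw [← inner_conj_symm, inner_lift_liftDir, inner_conj_symm]
  rw [fsLocal_apply, hopfForm_eq (lift_ne_zero k w), inner_liftDir_liftDir, inner_lift_liftDir, h,
    norm_lift_sq]

theorem isMetricNear_fsLocal (k : Fin (m + 1)) (w : EuclideanSpace ℂ (Fin m)) :
    IsMetricNear (fsLocal k) w where
  symm := Eventually.of_forall fun x v u => fsLocal_symm k x v u
  pos := Eventually.of_forall fun x v hv => by
    refine lt_of_lt_of_le ?_ (le_fsLocal k x v)
    have h1 := norm_pos_iff.2 (lift_ne_zero k x)
    have h2 := norm_pos_iff.2 hv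
    positivity
  differentiableAt := (contDiff_fsLocal k).differentiable (by simp) w

theorem hasDerivAt_norm_sq_line (w v : EuclideanSpace ℂ (Fin m)) :
    HasDerivAt (fun t : ℝ => ‖w + t • v‖ ^ 2) (2 * (inner ℂ w v).re) 0 := by
  have hc : HasDerivAt (fun t : ℝ => w + t • v) v 0 := by
    simpa using ((hasDerivAt_id (0 : ℝ)).smul_const v).const_add w
  have h := Complex.reCLM.hasFDerivAt.comp_hasDerivAt (0 : ℝ) (hc.inner ℂ hc)
  have h2 : (fun t : ℝ => ‖w + t • v‖ ^ 2) =
      Complex.reCLM ∘ fun t : ℝ => inner ℂ (w + t • v) (w + t • v) := by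
    funext t
    rw [Function.comp_apply, inner_self_eq_norm_sq_to_K]
    simp [← Complex.ofReal_pow]
  rw [h2]
  refine h.congr_deriv ?_
  simp only [zero_smul, add_zero, Complex.reCLM_apply, Complex.add_re]
  rw [← inner_conj_symm v w, Complex.conj_re, two_mul]

/-- Quotient rule for the explicit form `fsLocal_eq` along the line `w + tv`, where `1 + |w|²` has
derivative `2 Re⟨w, v⟩`. -/
theorem fderiv_fsLocal (k : Fin (m + 1)) (w v a b : EuclideanSpace ℂ (Fin m)) :
    fderiv ℝ (fsLocal k) w v a b =
      -(2 * (inner ℂ w v).re * (inner ℂ a b).re) / (1 + ‖w‖ ^ 2) ^ 2 -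
      (inner ℂ a v * inner ℂ w b + inner ℂ a w * inner ℂ v b).re / (1 + ‖w‖ ^ 2) ^ 2 +
      4 * (inner ℂ w v).re * (inner ℂ a w * inner ℂ w b).re / (1 + ‖w‖ ^ 2) ^ 3 := by
  have hc : HasDerivAt (fun t : ℝ => w + t • v) v 0 := by
    simpa using ((hasDerivAt_id (0 : ℝ)).smul_const v).const_add w
  have hN : (1 + ‖w‖ ^ 2) ≠ 0 := by positivity
  have h1 : HasDerivAt (fun t : ℝ => fsLocal k (w + t • v) a b)
      (fderiv ℝ (fsLocal k) w v a b) 0 := by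
    have hd : DifferentiableAt ℝ (fun y => fsLocal k y a b) w :=
      (contDiff_fsLocal_apply k a b).differentiable (by simp) w
    rw [← (isMetricNear_fsLocal k w).fderiv_apply]
    exact hd.hasFDerivAt.hasLineDerivAt v
  have hn := (hasDerivAt_norm_sq_line w v).const_add 1
  have h3 := Complex.reCLM.hasFDerivAt.comp_hasDerivAt (0 : ℝ)
    (((hasDerivAt_const (0 : ℝ) a).inner ℂ hc).mul (hc.inner ℂ (hasDerivAt_const (0 : ℝ) b)))
  have h4 := ((hasDerivAt_const (0 : ℝ) (inner ℂ a b).re).div hn (by simpa using hN)).sub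
    (h3.div (hn.pow 2) (by simpa using hN))
  have h5 := h1.unique (h4.congr_of_eventuallyEq (Eventually.of_forall fun t => by
    show fsLocal k (w + t • v) a b = _
    rw [fsLocal_eq]
    rfl))
  rw [h5]
  simp only [zero_smul, add_zero, inner_zero_left, inner_zero_right, zero_add, Pi.mul_apply,
    Function.comp_apply, Pi.pow_apply, Complex.reCLM_apply, zero_mul, zero_sub]
  field_simp
  push_cast
  ring

/-- The Christoffel symbols of the Fubini–Study metric. -/
theorem coordChristoffel_fsLocal (k : Fin (m + 1)) (x w v : EuclideanSpace ℂ (Fin m)) :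
    coordChristoffel (fsLocal k) x w v =
      (-(1 + ‖x‖ ^ 2 : ℝ) : ℂ)⁻¹ • (inner ℂ x v • w + inner ℂ x w • v) := by
  have hG := isMetricNear_fsLocal k x
  refine hG.isInvertible.injective (ContinuousLinearMap.ext fun u => ?_)
  have h := two_mul_coordChristoffel hG.isInvertible v w u
  have hN : (1 + ‖x‖ ^ 2) ≠ 0 := by positivity
  -- As the metric is injective, the claimed value need only satisfy Koszul's formula. It is complex
  -- linear in both arguments.
  suffices h' : 2 * fsLocal k x ((-(1 + ‖x‖ ^ 2 : ℝ) : ℂ)⁻¹ • (inner ℂ x v • w + inner ℂ x w • v)) u =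
      fderiv ℝ (fsLocal k) x w v u + fderiv ℝ (fsLocal k) x v w u -
        fderiv ℝ (fsLocal k) x u w v by linarith
  have hc : (-(1 + ‖x‖ ^ 2 : ℝ) : ℂ)⁻¹ = ((-(1 + ‖x‖ ^ 2)⁻¹ : ℝ) : ℂ) := by
    push_cast
    rw [inv_neg]
  rw [hc]
  simp only [fderiv_fsLocal, fsLocal_eq, inner_smul_left, inner_add_left, Complex.conj_ofReal]
  rw [← inner_conj_symm v x, ← inner_conj_symm w x, ← inner_conj_symm u v,
    ← inner_conj_symm w v]
  simp only [Complex.mul_re, Complex.mul_im, Complex.add_re, Complex.add_im,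
    Complex.conj_re, Complex.conj_im, Complex.ofReal_re, Complex.ofReal_im]
  field_simp
  ring

/-- The real trace of a complex linear endomorphism is twice the real part of its complex trace. -/
theorem trace_eq_two_mul_re (L : EuclideanSpace ℂ (Fin m) →ₗ[ℝ] EuclideanSpace ℂ (Fin m))
    (b : Fin m → EuclideanSpace ℂ (Fin m)) (hL : ∀ v, L v = ∑ j, v j • b j) :
    LinearMap.trace ℝ _ L = 2 * (∑ j, b j j).re := by
  let p : Fin m → EuclideanSpace ℂ (Fin m) →L[ℝ] ℂ := fun j =>
    (EuclideanSpace.proj j : EuclideanSpace ℂ (Fin m) →L[ℂ] ℂ).restrictScalars ℝ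
  have h : L = ∑ j, (((Complex.reCLM ∘L p j : EuclideanSpace ℂ (Fin m) →L[ℝ] ℝ) :
      EuclideanSpace ℂ (Fin m) →ₗ[ℝ] ℝ).smulRight (b j) +
      ((Complex.imCLM ∘L p j : EuclideanSpace ℂ (Fin m) →L[ℝ] ℝ) :
      EuclideanSpace ℂ (Fin m) →ₗ[ℝ] ℝ).smulRight (Complex.I • b j)) := by
    refine LinearMap.ext fun v => ?_
    rw [hL, LinearMap.sum_apply]
    refine Finset.sum_congr rfl fun j _ => ?_
    show v j • b j = (v j).re • b j + (v j).im • Complex.I • b j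
    conv_lhs => rw [← Complex.re_add_im (v j)]
    rw [add_smul, mul_smul, Complex.coe_smul, Complex.coe_smul]
  rw [h, map_sum, Complex.re_sum, Finset.mul_sum]
  refine Finset.sum_congr rfl fun j _ => ?_
  rw [map_add, LinearMap.trace_smulRight, LinearMap.trace_smulRight]
  show (b j j).re + ((Complex.I • b j) j).im = _
  simp
  ring

/-! ### Rayleigh quotients: gradient and divergence. -/

theorem horizontal_add_smul_self {z : EuclideanSpace ℂ (Fin (m + 1))} (hz : z ≠ 0)
    (a : EuclideanSpace ℂ (Fin (m + 1))) (c : ℂ) :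
    horizontal z (a + c • z) = horizontal z a := by
  have h : horizontal z z = 0 := by
    rw [horizontal, div_self (inner_self_ne_zero.2 hz), one_smul, sub_self]
  rw [horizontal_add, horizontal_smul, h, smul_zero, add_zero]

/-- The value at `z` of the function `[z] ↦ ⟨z, A z⟩ / |z|²`. -/
def rayleigh (A : EuclideanSpace ℂ (Fin (m + 1)) →L[ℂ] EuclideanSpace ℂ (Fin (m + 1)))
    (z : EuclideanSpace ℂ (Fin (m + 1))) : ℂ :=
  inner ℂ z (A z) / ((‖z‖ ^ 2 : ℝ) : ℂ)

/-- The gradient of the Rayleigh quotient of a Hermitian `A`, in the `k`-th affine chart: half of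
it is the derivative of the action of the flow of `A`. -/
def hermitianField (k : Fin (m + 1))
    (A : EuclideanSpace ℂ (Fin (m + 1)) →L[ℂ] EuclideanSpace ℂ (Fin (m + 1)))
    (w : EuclideanSpace ℂ (Fin m)) : EuclideanSpace ℂ (Fin m) :=
  (2 : ℂ) • (omitCoord k (A (lift k w)) - A (lift k w) k • w)

variable {A B : EuclideanSpace ℂ (Fin (m + 1)) →L[ℂ] EuclideanSpace ℂ (Fin (m + 1))}

/-- Modulo the vertical direction, the lift of the field is `2 A(lift k w)`. -/
theorem fsLocal_hermitianField (k : Fin (m + 1)) (w v : EuclideanSpace ℂ (Fin m)) :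
    fsLocal k w (hermitianField k A w) v =
      2 * hopfForm (lift k w) (A (lift k w)) (liftDir k v) := by
  rw [fsLocal_apply, hermitianField, liftDir_smul, liftDir_omitCoord_sub, hopfForm, hopfForm,
    horizontal_smul, horizontal_add_smul_self (lift_ne_zero k w), inner_smul_left]
  simp
  ring

theorem conj_inner_apply (hA : ∀ x y, inner ℂ (A x) y = inner ℂ x (A y))
    (z : EuclideanSpace ℂ (Fin (m + 1))) :
    (starRingEnd ℂ) (inner ℂ z (A z)) = inner ℂ z (A z) := by
  rw [inner_conj_symm, hA]

theorem ofReal_re_inner_apply (hA : ∀ x y, inner ℂ (A x) y = inner ℂ x (A y))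
    (z : EuclideanSpace ℂ (Fin (m + 1))) :
    ((inner ℂ z (A z) : ℂ).re : ℂ) = inner ℂ z (A z) :=
  Complex.conj_eq_iff_re.1 (conj_inner_apply hA z)

/-- The product of the horizontal parts is the full product minus that of the vertical components,
which are real for Hermitian operators; the two factors `2` give the `4`. -/
theorem fsLocal_hermitianField_hermitianField (hA : ∀ x y, inner ℂ (A x) y = inner ℂ x (A y))
    (hB : ∀ x y, inner ℂ (B x) y = inner ℂ x (B y))
    (k : Fin (m + 1)) (w : EuclideanSpace ℂ (Fin m)) :
    fsLocal k w (hermitianField k A w) (hermitianField k B w) =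
      4 * ((inner ℂ (A (lift k w)) (B (lift k w))).re / ‖lift k w‖ ^ 2 -
        (rayleigh A (lift k w)).re * (rayleigh B (lift k w)).re) := by
  have hN : ‖lift k w‖ ≠ 0 := norm_ne_zero_iff.2 (lift_ne_zero k w)
  rw [fsLocal_hermitianField, hermitianField, liftDir_smul, liftDir_omitCoord_sub, hopfForm,
    horizontal_smul, horizontal_add_smul_self (lift_ne_zero k w), inner_smul_right,
    inner_horizontal (lift_ne_zero k w), hA (lift k w) (lift k w), ← ofReal_re_inner_apply hA, ← ofReal_re_inner_apply hB,
    rayleigh, rayleigh, Complex.div_ofReal_re, Complex.div_ofReal_re]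
  have h2 : ∀ c : ℂ, (2 * c).re = 2 * c.re := fun c => by simp
  rw [← Complex.ofReal_mul, ← Complex.ofReal_div, h2, Complex.sub_re, Complex.ofReal_re]
  field_simp
  ring

theorem contDiff_rayleigh_lift (k : Fin (m + 1)) :
    ContDiff ℝ ∞ fun w : EuclideanSpace ℂ (Fin m) => rayleigh A (lift k w) := by
  have hl : ContDiff ℝ ∞ fun w : EuclideanSpace ℂ (Fin m) => lift k w :=
    contDiff_piLp' _ fun i => (contDiff_lift k i).of_le (by simp)
  have hA : ContDiff ℝ ∞ fun w : EuclideanSpace ℂ (Fin m) => A (lift k w) :=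
    (A.restrictScalars ℝ).contDiff.comp hl
  simp only [rayleigh, div_eq_mul_inv]
  refine (hl.inner ℂ hA).mul (ContDiff.inv (Complex.ofRealCLM.contDiff.comp (hl.norm_sq ℂ))
    fun w => ?_)
  simpa using lift_ne_zero k w

/-- `hermitianField` is the gradient of the Rayleigh quotient. -/
theorem fsLocal_hermitianField_eq_fderiv (hA : ∀ x y, inner ℂ (A x) y = inner ℂ x (A y))
    (k : Fin (m + 1)) (w v : EuclideanSpace ℂ (Fin m)) :
    fsLocal k w (hermitianField k A w) v =
      fderiv ℝ (fun w => (rayleigh A (lift k w)).re) w v := by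
  have hd : DifferentiableAt ℝ (fun w => (rayleigh A (lift k w)).re) w :=
    (Complex.reCLM.contDiff.comp (contDiff_rayleigh_lift k)).differentiable (by simp) w
  have h1 := hd.hasFDerivAt.hasLineDerivAt v
  have hN : ‖lift k w‖ ^ 2 ≠ 0 := pow_ne_zero 2 (norm_ne_zero_iff.2 (lift_ne_zero k w))
  have hline : ∀ t : ℝ, lift k (w + t • v) = lift k w + t • liftDir k v := fun t => by
    rw [lift_add, ← Complex.coe_smul, liftDir_smul, Complex.coe_smul]
  have hc : HasDerivAt (fun t : ℝ => lift k w + t • liftDir k v) (liftDir k v) 0 := by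
    simpa using ((hasDerivAt_id (0 : ℝ)).smul_const (liftDir k v)).const_add (lift k w)
  have hAc : HasDerivAt (fun t : ℝ => A (lift k w + t • liftDir k v)) (A (liftDir k v)) 0 :=
    (A.restrictScalars ℝ).hasFDerivAt.comp_hasDerivAt (0 : ℝ) hc
  have h2 := Complex.reCLM.hasFDerivAt.comp_hasDerivAt (0 : ℝ) (hc.inner ℂ hAc)
  have h3 := h2.div (hasDerivAt_norm_sq_line (lift k w) (liftDir k v)) (by simpa using hN)
  have h4 := h1.unique (h3.congr_of_eventuallyEq (Eventually.of_forall fun t => by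
    show (rayleigh A (lift k (w + t • v))).re = _
    rw [rayleigh, Complex.div_ofReal_re, hline]
    rfl))
  rw [h4, fsLocal_hermitianField, hopfForm_eq (lift_ne_zero k w), hA (lift k w) (lift k w),
    ← ofReal_re_inner_apply hA, Complex.re_ofReal_mul]
  -- Being Hermitian makes the two halves `⟨v, Az⟩` and `⟨z, Av⟩` of the derivative have the same
  -- real part, whence the factor `2`.
  have h5 : (inner ℂ (liftDir k v) (A (lift k w))).re =
      (inner ℂ (A (lift k w)) (liftDir k v)).re := by
    rw [← inner_conj_symm, Complex.conj_re]
  simp only [Function.comp_apply, zero_smul, add_zero, Complex.reCLM_apply, Complex.add_re, h5,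
    ← hA (lift k w) (liftDir k v)]
  field_simp
  ring

/-- The trace of `A`. -/
def matrixTrace (A : EuclideanSpace ℂ (Fin (m + 1)) →L[ℂ] EuclideanSpace ℂ (Fin (m + 1))) : ℂ :=
  ∑ i, A (EuclideanSpace.single i 1) i

/-- The field is holomorphic in the chart, so its derivative is complex linear; with Christoffel
symbols of the same kind, its divergence is twice the real part of a complex trace. -/
theorem fderiv_hermitianField (k : Fin (m + 1)) (w v : EuclideanSpace ℂ (Fin m)) :
    fderiv ℝ (hermitianField k A) w v = (2 : ℂ) • (omitCoord k (A (liftDir k v)) -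
      (A (lift k w) k • v + A (liftDir k v) k • w)) := by
  have h1 : HasFDerivAt (fun w => A (lift k w)) _ w :=
    (A.restrictScalars ℝ).hasFDerivAt.comp w (hasFDerivAt_lift k w)
  have h2 := ((omitCoord k).restrictScalars ℝ).hasFDerivAt.comp w h1
  have h3 := (((EuclideanSpace.proj k : EuclideanSpace ℂ (Fin (m + 1)) →L[ℂ] ℂ).restrictScalars
    ℝ).hasFDerivAt.comp w h1).smul (hasFDerivAt_id w)
  have h4 : HasFDerivAt (hermitianField k A) _ w := (h2.sub h3).const_smul (2 : ℂ)
  rw [h4.fderiv]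
  simp

theorem liftDir_single (k : Fin (m + 1)) (j : Fin m) :
    liftDir k (EuclideanSpace.single j 1) = EuclideanSpace.single (k.succAbove j) 1 := by
  ext i
  rcases Fin.eq_self_or_eq_succAbove k i with rfl | ⟨l, rfl⟩
  · simp [(Fin.succAbove_ne _ j).symm]
  · simp

theorem apply_eq_sum (L : EuclideanSpace ℂ (Fin m) →ₗ[ℂ] EuclideanSpace ℂ (Fin m))
    (v : EuclideanSpace ℂ (Fin m)) : L v = ∑ j, v j • L (EuclideanSpace.single j 1) := by
  conv_lhs => rw [← (EuclideanSpace.basisFun (Fin m) ℂ).sum_repr v]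
  simp

theorem inner_lift (k : Fin (m + 1)) (w : EuclideanSpace ℂ (Fin m))
    (y : EuclideanSpace ℂ (Fin (m + 1))) :
    inner ℂ (lift k w) y = y k + inner ℂ w (omitCoord k y) := by
  rw [PiLp.inner_apply, PiLp.inner_apply, Fin.sum_univ_succAbove _ k]
  simp

theorem apply_lift_eq (k i : Fin (m + 1)) (w : EuclideanSpace ℂ (Fin m)) :
    A (lift k w) i = A (EuclideanSpace.single k 1) i +
      ∑ j, w j * A (EuclideanSpace.single (k.succAbove j) 1) i := by
  have h : lift k w = EuclideanSpace.single k 1 + liftDir k w := by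
    ext i
    rcases Fin.eq_self_or_eq_succAbove k i with rfl | ⟨l, rfl⟩
    · simp
    · simp [Fin.succAbove_ne]
  have h2 : liftDir k w = ∑ j, w j • EuclideanSpace.single (k.succAbove j) (1 : ℂ) := by
    conv_lhs => rw [← (EuclideanSpace.basisFun (Fin m) ℂ).sum_repr w]
    rw [← liftDirL_apply, map_sum]
    simp [liftDir_single]
  rw [h, h2]
  simp

/-- The divergence of the gradient of the Rayleigh quotient. -/
theorem trace_covDeriv_hermitianField (k : Fin (m + 1)) (w : EuclideanSpace ℂ (Fin m)) :
    LinearMap.trace ℝ (EuclideanSpace ℂ (Fin m)) (fderiv ℝ (hermitianField k A) w +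
      coordChristoffel (fsLocal k) w (hermitianField k A w) :
        EuclideanSpace ℂ (Fin m) →L[ℝ] EuclideanSpace ℂ (Fin m)) =
      4 * (matrixTrace A).re - 4 * (m + 1) * (rayleigh A (lift k w)).re := by
  set X := hermitianField k A w with hX
  set N : ℂ := ((1 + ‖w‖ ^ 2 : ℝ) : ℂ) with hN
  have hN0 : N ≠ 0 := by
    rw [hN, Complex.ofReal_ne_zero]
    positivity
  let L : EuclideanSpace ℂ (Fin m) →ₗ[ℂ] EuclideanSpace ℂ (Fin m) :=
    { toFun := fun v => (2 : ℂ) • (omitCoord k (A (liftDir k v)) -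
        (A (lift k w) k • v + A (liftDir k v) k • w)) +
        (-N)⁻¹ • (inner ℂ w v • X + inner ℂ w X • v)
      map_add' := fun v v' => by
        ext j
        simp [liftDir_add]
        ring
      map_smul' := fun c v => by
        ext j
        simp [liftDir_smul]
        ring }
  rw [trace_eq_two_mul_re _ (fun j => L (EuclideanSpace.single j 1)) (fun v => by
    rw [← apply_eq_sum]
    simp only [ContinuousLinearMap.coe_coe, _root_.add_apply, fderiv_hermitianField,
      coordChristoffel_fsLocal]
    rfl)]
  have hLj : ∀ j, L (EuclideanSpace.single j 1) j =
      2 * (A (EuclideanSpace.single (k.succAbove j) 1) (k.succAbove j) -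
        (A (lift k w) k + w j * A (EuclideanSpace.single (k.succAbove j) 1) k)) +
        (-N)⁻¹ * ((starRingEnd ℂ) (w j) * X j + inner ℂ w X) := fun j => by
    show (show EuclideanSpace ℂ (Fin m) from (2 : ℂ) • (omitCoord k (A (liftDir k (EuclideanSpace.single j 1))) -
        (A (lift k w) k • EuclideanSpace.single j 1 +
          A (liftDir k (EuclideanSpace.single j 1)) k • w)) +
        (-N)⁻¹ • (inner ℂ w (EuclideanSpace.single j (1 : ℂ)) • X +
          inner ℂ w X • EuclideanSpace.single j 1)) j = _
    rw [liftDir_single]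
    simp [EuclideanSpace.inner_single_right]
    ring
  have htr : matrixTrace A = A (EuclideanSpace.single k 1) k +
      ∑ j, A (EuclideanSpace.single (k.succAbove j) 1) (k.succAbove j) :=
    Fin.sum_univ_succAbove _ k
  have hwX : ∑ j, (starRingEnd ℂ) (w j) * X j = inner ℂ w X := by
    rw [PiLp.inner_apply]
    exact Finset.sum_congr rfl fun j _ => by simp [mul_comm]
  have hww : inner ℂ w w = N - 1 := by
    rw [inner_self_eq_norm_sq_to_K, hN]
    push_cast
    simp
  -- Pairing the field with `w` recovers the Rayleigh quotient; in the trace below, the remaining `A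
  -- (lift k w) k` cancels.
  have hXw : inner ℂ w X = 2 * N * (rayleigh A (lift k w) - A (lift k w) k) := by
    have h1 : rayleigh A (lift k w) * N = A (lift k w) k + inner ℂ w (omitCoord k (A (lift k w))) := by
      rw [← inner_lift, rayleigh, norm_lift_sq, ← hN, div_mul_cancel₀ _ hN0]
    rw [hX, hermitianField, inner_smul_right, inner_sub_right, inner_smul_right, hww]
    linear_combination -2 * h1
  have hsum : ∑ j, L (EuclideanSpace.single j 1) j =
      2 * matrixTrace A - 2 * (m + 1) * rayleigh A (lift k w) := by
    simp only [hLj, Finset.sum_add_distrib, ← Finset.mul_sum, Finset.sum_sub_distrib, hwX]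
    have h1 := apply_lift_eq (A := A) k k w
    simp only [Finset.sum_const, Finset.card_univ, Fintype.card_fin, nsmul_eq_mul]
    rw [hXw, htr]
    field_simp
    linear_combination h1
  rw [hsum]
  simp
  ring

/-- A vector representing the point `p`. -/
def chartRep (p : CProj m) : EuclideanSpace ℂ (Fin (m + 1)) :=
  lift (chartIndex p) (affineChart (chartIndex p) p)

theorem chartRep_ne_zero (p : CProj m) : chartRep p ≠ 0 := lift_ne_zero _ _

theorem apply_eq_of_mem_affineChart_source {V : Type*} {F : CProj m → V} {f : EuclideanSpace ℂ (Fin (m + 1)) → V}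
    (hF : ∀ z (hz : z ≠ 0), F (Projectivization.mk ℂ z hz) = f z) (k : Fin (m + 1))
    {p : CProj m} (hp : p ∈ (affineChart k).source) : F p = f (lift k (affineChart k p)) := by
  conv_lhs => rw [← (affineChart k).left_inv hp]
  exact hF _ _

theorem eq_apply_chartRep {V : Type*} {F : CProj m → V} {f : EuclideanSpace ℂ (Fin (m + 1)) → V}
    (hF : ∀ z (hz : z ≠ 0), F (Projectivization.mk ℂ z hz) = f z) (p : CProj m) :
    F p = f (chartRep p) :=
  apply_eq_of_mem_affineChart_source hF (chartIndex p) (mem_chart_source (EuclideanSpace ℂ (Fin m)) p)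

/-- A function on `ℂP^m` with smooth local expressions in the affine charts is smooth. -/
theorem contMDiff_of_contDiff_lift {V : Type*} [NormedAddCommGroup V] [NormedSpace ℝ V]
    {F : CProj m → V} {f : EuclideanSpace ℂ (Fin (m + 1)) → V}
    (hF : ∀ z (hz : z ≠ 0), F (Projectivization.mk ℂ z hz) = f z)
    (hf : ∀ k, ContDiff ℝ ∞ fun w : EuclideanSpace ℂ (Fin m) => f (lift k w)) :
    ContMDiff 𝓘(ℝ, EuclideanSpace ℂ (Fin m)) 𝓘(ℝ, V) ∞ F := by
  intro p
  refine ((hf (chartIndex p)).contMDiff.contMDiffAt.comp p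
    (contMDiffAt_extChartAt (I := 𝓘(ℝ, EuclideanSpace ℂ (Fin m))) (x := p))).congr_of_eventuallyEq ?_
  filter_upwards [(chartAt (EuclideanSpace ℂ (Fin m)) p).open_source.mem_nhds
    (mem_chart_source _ p)] with q hq
  exact apply_eq_of_mem_affineChart_source hF (chartIndex p) hq

variable {C : EuclideanSpace ℂ (Fin (m + 1)) →L[ℂ] EuclideanSpace ℂ (Fin (m + 1))}

/-! ### Laplacian and gradient products for Hermitian Rayleigh quotients. -/

section Hermitian

variable {u : CProj m → ℝ}

theorem contMDiff_of_eq_rayleigh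
    (hu : ∀ z (hz : z ≠ 0), u (Projectivization.mk ℂ z hz) = (rayleigh A z).re) :
    ContMDiff 𝓘(ℝ, EuclideanSpace ℂ (Fin m)) 𝓘(ℝ, ℝ) ∞ u :=
  contMDiff_of_contDiff_lift hu fun k =>
    Complex.reCLM.contDiff.comp (contDiff_rayleigh_lift k)

/-- Both fields represent `du` through the same invertible metric. An affine chart has all of `ℂ^m`
as target, so the equality holds everywhere. -/
theorem vectorFieldInChart_gradient (hA : ∀ x y, inner ℂ (A x) y = inner ℂ x (A y))
    (hu : ∀ z (hz : z ≠ 0), u (Projectivization.mk ℂ z hz) = (rayleigh A z).re) (p : CProj m) :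
    vectorFieldInChart p (gradient (fubiniStudy m) u) = hermitianField (chartIndex p) A := by
  funext x
  have hG := (isMetricNear_fsLocal (chartIndex p) x).isInvertible
  refine hG.injective (ContinuousLinearMap.ext fun v => ?_)
  have h := metricInChart_gradient (fubiniStudy m) (contMDiff_of_eq_rayleigh hu) p (x := x)
    trivial v
  rw [metricInChart_fubiniStudy] at h
  rw [h, fsLocal_hermitianField_eq_fderiv hA]
  congr 2
  funext w
  exact hu _ _

theorem laplacian_eq (hA : ∀ x y, inner ℂ (A x) y = inner ℂ x (A y))
    (hu : ∀ z (hz : z ≠ 0), u (Projectivization.mk ℂ z hz) = (rayleigh A z).re) (p : CProj m) :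
    laplacian (fubiniStudy m) u p = 4 * (matrixTrace A).re - 4 * (m + 1) * u p := by
  have hG : metricInChart (fubiniStudy m) p = fsLocal (chartIndex p) :=
    funext (metricInChart_fubiniStudy p)
  rw [laplacian, divergence, vectorFieldInChart_gradient hA hu, christoffel_eq, hG,
    trace_covDeriv_hermitianField, eq_apply_chartRep hu p]
  rfl

theorem inner_gradient_gradient (hA : ∀ x y, inner ℂ (A x) y = inner ℂ x (A y))
    (hB : ∀ x y, inner ℂ (B x) y = inner ℂ x (B y)) {u' : CProj m → ℝ}
    (hu : ∀ z (hz : z ≠ 0), u (Projectivization.mk ℂ z hz) = (rayleigh A z).re)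
    (hu' : ∀ z (hz : z ≠ 0), u' (Projectivization.mk ℂ z hz) = (rayleigh B z).re)
    (p : CProj m) :
    (fubiniStudy m).inner p (gradient (fubiniStudy m) u p) (gradient (fubiniStudy m) u' p) =
      4 * ((inner ℂ (A (chartRep p)) (B (chartRep p))).re / ‖chartRep p‖ ^ 2 - u p * u' p) := by
  have h := metricInChart_vectorField (fubiniStudy m) p
    (x := chartAt (EuclideanSpace ℂ (Fin m)) p p) trivial (gradient (fubiniStudy m) u)
    (gradient (fubiniStudy m) u')
  have hp : (chartAt (EuclideanSpace ℂ (Fin m)) p).symm (chartAt (EuclideanSpace ℂ (Fin m)) p p) =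
    p := (chartAt (EuclideanSpace ℂ (Fin m)) p).left_inv (mem_chart_source _ p)
  rw [hp, metricInChart_fubiniStudy, vectorFieldInChart_gradient hA hu,
    vectorFieldInChart_gradient hB hu', fsLocal_hermitianField_hermitianField hA hB] at h
  rw [← h, eq_apply_chartRep hu p, eq_apply_chartRep hu' p]
  rfl

end Hermitian

/-! ### Decomposition of an operator into Hermitian operators. -/

/-- The Hermitian part of `C`. -/
def hermitianPart (C : EuclideanSpace ℂ (Fin (m + 1)) →L[ℂ] EuclideanSpace ℂ (Fin (m + 1))) :
    EuclideanSpace ℂ (Fin (m + 1)) →L[ℂ] EuclideanSpace ℂ (Fin (m + 1)) :=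
  (1 / 2 : ℂ) • (C + C.adjoint)

/-- The operator `B` such that `C - i B` is the Hermitian part of `C`. -/
def skewPart (C : EuclideanSpace ℂ (Fin (m + 1)) →L[ℂ] EuclideanSpace ℂ (Fin (m + 1))) :
    EuclideanSpace ℂ (Fin (m + 1)) →L[ℂ] EuclideanSpace ℂ (Fin (m + 1)) :=
  (-(Complex.I / 2)) • (C - C.adjoint)

theorem hermitianPart_apply (z : EuclideanSpace ℂ (Fin (m + 1))) :
    hermitianPart C z = (1 / 2 : ℂ) • (C z + C.adjoint z) := rfl

theorem skewPart_apply (z : EuclideanSpace ℂ (Fin (m + 1))) :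
    skewPart C z = (-(Complex.I / 2)) • (C z - C.adjoint z) := rfl

theorem inner_hermitianPart (x y : EuclideanSpace ℂ (Fin (m + 1))) :
    inner ℂ (hermitianPart C x) y = inner ℂ x (hermitianPart C y) := by
  simp only [hermitianPart_apply, inner_smul_left, inner_smul_right, inner_add_left,
    inner_add_right, ContinuousLinearMap.adjoint_inner_left,
    ContinuousLinearMap.adjoint_inner_right, map_div₀, map_one, map_ofNat]
  ring

theorem inner_skewPart (x y : EuclideanSpace ℂ (Fin (m + 1))) :
    inner ℂ (skewPart C x) y = inner ℂ x (skewPart C y) := by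
  simp only [skewPart_apply, inner_smul_left, inner_smul_right, inner_sub_left,
    inner_sub_right, ContinuousLinearMap.adjoint_inner_left,
    ContinuousLinearMap.adjoint_inner_right, map_neg, map_div₀, map_ofNat,
    Complex.conj_I]
  ring

theorem rayleigh_hermitianPart (z : EuclideanSpace ℂ (Fin (m + 1))) :
    (rayleigh (hermitianPart C) z).re = (rayleigh C z).re := by
  rw [rayleigh, rayleigh, Complex.div_ofReal_re, Complex.div_ofReal_re, hermitianPart_apply,
    inner_smul_right, inner_add_right, ContinuousLinearMap.adjoint_inner_right]
  have h : (inner ℂ (C z) z).re = (inner ℂ z (C z)).re := by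
    rw [← inner_conj_symm, Complex.conj_re]
  congr 1
  simp [h]
  ring

theorem rayleigh_skewPart (z : EuclideanSpace ℂ (Fin (m + 1))) :
    (rayleigh (skewPart C) z).re = (rayleigh C z).im := by
  rw [rayleigh, rayleigh, Complex.div_ofReal_re, Complex.div_ofReal_im, skewPart_apply,
    inner_smul_right, inner_sub_right, ContinuousLinearMap.adjoint_inner_right]
  have h : (inner ℂ (C z) z).im = -(inner ℂ z (C z)).im := by
    rw [← inner_conj_symm, Complex.conj_im]
  congr 1
  simp [h]
  ring

theorem matrixTrace_adjoint : matrixTrace C.adjoint = (starRingEnd ℂ) (matrixTrace C) := by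
  rw [matrixTrace, matrixTrace, map_sum]
  refine Finset.sum_congr rfl fun i _ => ?_
  have h : ∀ y : EuclideanSpace ℂ (Fin (m + 1)), y i = inner ℂ (EuclideanSpace.single i 1) y :=
    fun y => by simp [EuclideanSpace.inner_single_left]
  rw [h, h, ContinuousLinearMap.adjoint_inner_right, inner_conj_symm]

theorem matrixTrace_hermitianPart (h : matrixTrace C = 0) : matrixTrace (hermitianPart C) = 0 := by
  have h1 : matrixTrace (hermitianPart C) = (1 / 2 : ℂ) * (matrixTrace C + matrixTrace C.adjoint) := by
    simp only [matrixTrace, ← Finset.sum_add_distrib, Finset.mul_sum]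
    rfl
  rw [h1, matrixTrace_adjoint, h]
  simp

theorem matrixTrace_skewPart (h : matrixTrace C = 0) : matrixTrace (skewPart C) = 0 := by
  have h1 : matrixTrace (skewPart C) =
      (-(Complex.I / 2)) * (matrixTrace C - matrixTrace C.adjoint) := by
    simp only [matrixTrace, ← Finset.sum_sub_distrib, Finset.mul_sum]
    rfl
  rw [h1, matrixTrace_adjoint, h]
  simp

/-! ### Trace-free operators of square zero give eigenfunctions. -/

section SquareZero

variable {φ : CProj m → ℂ} (hφ : ∀ z (hz : z ≠ 0), φ (Projectivization.mk ℂ z hz) = rayleigh C z)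

include hφ

theorem re_eq_rayleigh (z : EuclideanSpace ℂ (Fin (m + 1))) (hz : z ≠ 0) :
    (φ (Projectivization.mk ℂ z hz)).re = (rayleigh (hermitianPart C) z).re := by
  rw [hφ, rayleigh_hermitianPart]

theorem im_eq_rayleigh (z : EuclideanSpace ℂ (Fin (m + 1))) (hz : z ≠ 0) :
    (φ (Projectivization.mk ℂ z hz)).im = (rayleigh (skewPart C) z).re := by
  rw [hφ, rayleigh_skewPart]

theorem tension_eq (htr : matrixTrace C = 0) (p : CProj m) :
    tension (fubiniStudy m) φ p = (-4 * (m + 1) : ℂ) * φ p := by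
  rw [tension, laplacian_eq inner_hermitianPart (re_eq_rayleigh hφ),
    laplacian_eq inner_skewPart (im_eq_rayleigh hφ), matrixTrace_hermitianPart htr,
    matrixTrace_skewPart htr]
  apply Complex.ext <;> simp

/-- As `⟨Cz, C*z⟩ = ⟨C²z, z⟩ = 0`, both Hermitian operators `A`, `B` satisfy `|Az|² = |Bz|² = (|Cz|²
+ |C*z|²) / 4`, and `⟨Az, Bz⟩` is purely imaginary. Only the products of function values survive. -/
theorem conformality_eq_neg_four_mul (hC : ∀ z, C (C z) = 0) (p : CProj m) :
    conformality (fubiniStudy m) φ φ p = -4 * φ p ^ 2 := by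
  have hA := inner_hermitianPart (C := C)
  have hB := inner_skewPart (C := C)
  have hu := re_eq_rayleigh hφ
  have hv := im_eq_rayleigh hφ
  rw [conformality, complexMetric, complexGradient, inner_gradient_gradient hA hA hu hu,
    inner_gradient_gradient hB hB hv hv, inner_gradient_gradient hA hB hu hv,
    inner_gradient_gradient hB hA hv hu]
  set z := chartRep p
  have h1 : inner ℂ (C z) (C.adjoint z) = 0 := by
    rw [ContinuousLinearMap.adjoint_inner_right, hC, inner_zero_left]
  have h2 : inner ℂ (C.adjoint z) (C z) = 0 := by
    rw [← inner_conj_symm, h1, map_zero]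
  have h3 : (inner ℂ (C z) (C z)).im = 0 := inner_self_im (𝕜 := ℂ) _
  have h4 : (inner ℂ (C.adjoint z) (C.adjoint z)).im = 0 := inner_self_im (𝕜 := ℂ) _
  have hAA : (inner ℂ (hermitianPart C z) (hermitianPart C z)).re =
      (inner ℂ (skewPart C z) (skewPart C z)).re := by
    simp only [hermitianPart_apply, skewPart_apply, inner_smul_left, inner_smul_right,
      inner_add_left, inner_add_right, inner_sub_left, inner_sub_right, h1, h2, map_neg,
      map_div₀, map_one, map_ofNat, Complex.conj_I]
    congr 1
    linear_combination (inner ℂ (C z) (C z) + inner ℂ (C.adjoint z) (C.adjoint z)) / 4 *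
      Complex.I_sq
  have hAB : (inner ℂ (hermitianPart C z) (skewPart C z)).re = 0 := by
    simp only [hermitianPart_apply, skewPart_apply, inner_smul_left, inner_smul_right,
      inner_add_left, inner_sub_right, h1, h2]
    simp [h3, h4, -inner_self_eq_norm_sq_to_K]
  have hBA : (inner ℂ (skewPart C z) (hermitianPart C z)).re = 0 := by
    rw [← inner_conj_symm, Complex.conj_re, hAB]
  rw [hAA, hAB, hBA]
  apply Complex.ext <;> simp [pow_two] <;> ring

theorem isEigenfunction_of_sq_eq_zero (hC : ∀ z, C (C z) = 0) (htr : matrixTrace C = 0) :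
    IsEigenfunction (fubiniStudy m) φ :=
  ⟨contMDiff_of_contDiff_lift hφ fun k => contDiff_rayleigh_lift k, _, _,
    fun p => ⟨tension_eq hφ htr p, conformality_eq_neg_four_mul hφ hC p⟩⟩

/-- At a zero the squared gradient lengths are `4|Az|²/|z|²` and `4|Bz|²/|z|²`, so `Az = Bz = 0`;
then `C` and its adjoint, being `A ± iB`, kill `z`. -/
theorem apply_eq_zero_of_complexGradient_eq_zero {p : CProj m} (hp : φ p = 0)
    (h : complexGradient (fubiniStudy m) φ p = 0) :
    C (chartRep p) = 0 ∧ C.adjoint (chartRep p) = 0 := by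
  have hu : gradient (fubiniStudy m) (fun q => (φ q).re) p = 0 := congrArg Prod.fst h
  have hv : gradient (fubiniStudy m) (fun q => (φ q).im) p = 0 := congrArg Prod.snd h
  have h1 := inner_gradient_gradient (u := fun q => (φ q).re) (u' := fun q => (φ q).re)
    inner_hermitianPart inner_hermitianPart (re_eq_rayleigh hφ)
    (re_eq_rayleigh hφ) p
  have h2 := inner_gradient_gradient (u := fun q => (φ q).im) (u' := fun q => (φ q).im)
    inner_skewPart inner_skewPart (im_eq_rayleigh hφ)
    (im_eq_rayleigh hφ) p
  have hN : ‖chartRep p‖ ^ 2 ≠ 0 := pow_ne_zero 2 (norm_ne_zero_iff.2 (chartRep_ne_zero p))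
  have hzero : ∀ y : EuclideanSpace ℂ (Fin (m + 1)),
      0 = 4 * ((inner ℂ y y).re / ‖chartRep p‖ ^ 2 - 0 * 0) → y = 0 := fun y hy => by
    have h3 : (inner ℂ y y).re = 0 := by
      rw [mul_zero, sub_zero, eq_comm, mul_eq_zero, div_eq_zero_iff] at hy
      exact (hy.resolve_left four_ne_zero).resolve_right hN
    rw [← inner_self_eq_zero (𝕜 := ℂ)]
    exact Complex.ext h3 (inner_self_im (𝕜 := ℂ) y)
  rw [hu, hp, map_zero] at h1
  rw [hv, hp, map_zero] at h2
  have h3 := hzero _ h1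
  have h4 := hzero _ h2
  rw [hermitianPart_apply, smul_eq_zero_iff_right (by norm_num)] at h3
  rw [skewPart_apply, smul_eq_zero_iff_right (by simp), sub_eq_zero] at h4
  rw [← h4, ← two_smul ℂ, smul_eq_zero_iff_right two_ne_zero] at h3
  exact ⟨h3, h4 ▸ h3⟩

end SquareZero

end CProj

/-! ### The operator behind `Φ_a` and regularity of its zero fibre. -/

open RiemannianGeometry

variable {n : ℕ}

/-- The index of the coordinate `z_k`. -/
def fstIndex (k : Fin n) : Fin (2 * n - 1 + 1) := ⟨k, by have := k.isLt; omega⟩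

/-- The index of the coordinate `z_{n+k}`. -/
def sndIndex (k : Fin n) : Fin (2 * n - 1 + 1) := ⟨n + k, by have := k.isLt; omega⟩

theorem fstIndex_ne_sndIndex (k l : Fin n) : fstIndex k ≠ sndIndex l := fun h => by
  have h1 : (k : ℕ) = n + l := congrArg Fin.val h
  have := k.isLt
  omega

theorem fstIndex_injective : Function.Injective (fstIndex (n := n)) := fun _ _ h =>
  Fin.ext (congrArg Fin.val h :)

theorem sndIndex_injective : Function.Injective (sndIndex (n := n)) := fun k l h => by
  have h1 : n + (k : ℕ) = n + l := congrArg Fin.val h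
  exact Fin.ext (by omega)

/-- For `n = 0` truncated subtraction would leave one coordinate outside both blocks; for `n ≥ 1`
there are exactly `2n`. -/
theorem exists_eq_index (hn : 1 ≤ n) (i : Fin (2 * n - 1 + 1)) :
    (∃ k, i = fstIndex k) ∨ ∃ k, i = sndIndex k := by
  have hi := i.isLt
  by_cases h : (i : ℕ) < n
  · exact Or.inl ⟨⟨i, h⟩, rfl⟩
  · exact Or.inr ⟨⟨i - n, by omega⟩, Fin.ext (by simp [sndIndex]; omega)⟩

/-- The operator `C` with `Φ_a([z]) = ⟨z, C z⟩ / |z|²`. -/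
def phiOperator (a : EuclideanSpace ℂ (Fin n)) :
    EuclideanSpace ℂ (Fin (2 * n - 1 + 1)) →L[ℂ] EuclideanSpace ℂ (Fin (2 * n - 1 + 1)) :=
  ∑ k, (a k • (EuclideanSpace.proj (fstIndex k) :
    EuclideanSpace ℂ (Fin (2 * n - 1 + 1)) →L[ℂ] ℂ)).smulRight
      (EuclideanSpace.single (sndIndex k) (1 : ℂ))

variable {a b : EuclideanSpace ℂ (Fin n)}

theorem phiOperator_apply (z : EuclideanSpace ℂ (Fin (2 * n - 1 + 1))) :
    phiOperator a z = ∑ k, (a k * z (fstIndex k)) • EuclideanSpace.single (sndIndex k) (1 : ℂ) := by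
  simp [phiOperator]

theorem phiOperator_apply_fst (z : EuclideanSpace ℂ (Fin (2 * n - 1 + 1))) (k : Fin n) :
    phiOperator a z (fstIndex k) = 0 := by
  simp [phiOperator_apply, fstIndex_ne_sndIndex]

theorem phiOperator_apply_snd (z : EuclideanSpace ℂ (Fin (2 * n - 1 + 1))) (k : Fin n) :
    phiOperator a z (sndIndex k) = a k * z (fstIndex k) := by
  simp [phiOperator_apply, sndIndex_injective.eq_iff, Pi.single_apply]

/-- The image lies in the second block of coordinates, on which the operator vanishes. -/
theorem phiOperator_phiOperator (z : EuclideanSpace ℂ (Fin (2 * n - 1 + 1))) :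
    phiOperator a (phiOperator a z) = 0 := by
  rw [phiOperator_apply]
  simp [phiOperator_apply_fst]

theorem matrixTrace_phiOperator (hn : 1 ≤ n) : CProj.matrixTrace (phiOperator a) = 0 := by
  refine Finset.sum_eq_zero fun i _ => ?_
  obtain ⟨k, rfl⟩ | ⟨k, rfl⟩ := exists_eq_index hn i
  · exact phiOperator_apply_fst _ _
  · simp [phiOperator_apply_snd, fstIndex_ne_sndIndex]

theorem inner_phiOperator (z : EuclideanSpace ℂ (Fin (2 * n - 1 + 1))) :
    inner ℂ z (phiOperator a z) =
      ∑ k, a k * z (fstIndex k) * (starRingEnd ℂ) (z (sndIndex k)) := by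
  rw [phiOperator_apply, inner_sum]
  refine Finset.sum_congr rfl fun k _ => ?_
  rw [inner_smul_right]
  simp [EuclideanSpace.inner_single_right]

theorem projPhi_mk (a : EuclideanSpace ℂ (Fin n)) (z : EuclideanSpace ℂ (Fin (2 * n - 1 + 1)))
    (hz : z ≠ 0) : projPhi n a (Projectivization.mk ℂ z hz) = CProj.rayleigh (phiOperator a) z := by
  rw [CProj.rayleigh, inner_phiOperator]
  push_cast
  rfl

theorem projPhi_eq_zero_iff (a : EuclideanSpace ℂ (Fin n))
    (z : EuclideanSpace ℂ (Fin (2 * n - 1 + 1))) (hz : z ≠ 0) :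
    projPhi n a (Projectivization.mk ℂ z hz) = 0 ↔
      ∑ k, a k * z (fstIndex k) * (starRingEnd ℂ) (z (sndIndex k)) = 0 := by
  have h : ((‖z‖ ^ 2 : ℝ) : ℂ) ≠ 0 := by simpa using hz
  rw [projPhi_mk, CProj.rayleigh, inner_phiOperator, div_eq_zero_iff, or_iff_left h]

/-- On the zero set of `Φ_a`, the gradient of `Φ_a` does not vanish. -/
theorem complexGradient_projPhi_ne_zero (hn : 1 ≤ n) (ha : a ∈ paramSet n) {p : CProj (2 * n - 1)}
    (hp : projPhi n a p = 0) :
    complexGradient (CProj.fubiniStudy (2 * n - 1)) (projPhi n a) p ≠ 0 := fun h => by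
  obtain ⟨h1, h2⟩ := CProj.apply_eq_zero_of_complexGradient_eq_zero (projPhi_mk a) hp h
  refine CProj.chartRep_ne_zero p (PiLp.ext fun i => ?_)
  obtain ⟨k, rfl⟩ | ⟨k, rfl⟩ := exists_eq_index hn i
  · have h3 := phiOperator_apply_snd (a := a) (CProj.chartRep p) k
    rw [h1] at h3
    exact (mul_eq_zero.1 h3.symm).resolve_left (ha k)
  -- Moving the adjoint across tests `C* z = 0` against `e_k`; since `C e_k = a_k e_{n+k}`, this
  -- kills the coordinate `z_{n+k}`.
  · have h3 : inner ℂ (CProj.chartRep p) (phiOperator a (EuclideanSpace.single (fstIndex k) 1)) =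
        0 := by
      rw [← ContinuousLinearMap.adjoint_inner_left, h2, inner_zero_left]
    have h4 : phiOperator a (EuclideanSpace.single (fstIndex k) 1) =
        a k • EuclideanSpace.single (sndIndex k) 1 := by
      rw [phiOperator_apply]
      simp [fstIndex_injective.eq_iff]
    rw [h4, inner_smul_right, mul_eq_zero, or_iff_right (ha k),
      EuclideanSpace.inner_single_right] at h3
    simpa using h3

theorem preimage_projPhi_nonempty (hn : 1 ≤ n) (a : EuclideanSpace ℂ (Fin n)) :
    (projPhi n a ⁻¹' {0}).Nonempty := by
  -- All second-block coordinates of this point vanish, hence so does every summand.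
  have hz : (EuclideanSpace.single (fstIndex ⟨0, hn⟩) 1 :
      EuclideanSpace ℂ (Fin (2 * n - 1 + 1))) ≠ 0 := by simp
  refine ⟨Projectivization.mk ℂ _ hz, (projPhi_eq_zero_iff a _ hz).2 ?_⟩
  refine Finset.sum_eq_zero fun k _ => ?_
  simp [(fstIndex_ne_sndIndex _ k).symm]

/-! ### Dependence on the parameter. -/

theorem isOpen_paramSet (n : ℕ) : IsOpen (paramSet n) := by
  have h : paramSet n = ⋂ k, {a | a k ≠ 0} := by
    ext a
    simp [paramSet]
  rw [h]
  exact isOpen_iInter_of_finite fun k => isOpen_ne_fun (by fun_prop) continuous_const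

theorem paramSet_nonempty (n : ℕ) : (paramSet n).Nonempty :=
  ⟨WithLp.toLp 2 fun _ => 1, fun _ => one_ne_zero⟩

theorem differentiable_projPhi (p : CProj (2 * n - 1)) :
    Differentiable ℂ fun a => projPhi n a p := by
  induction p using Projectivization.ind with
  | h z hz =>
    simp only [projPhi_mk, CProj.rayleigh, inner_phiOperator, div_eq_mul_inv]
    fun_prop

/-- Linearity in `a` reduces joint smoothness to that of the finitely many functions given by the
standard basis vectors. -/
theorem contMDiff_projPhi (n : ℕ) :
    ContMDiff (𝓘(ℝ, EuclideanSpace ℂ (Fin n)).prod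
      𝓘(ℝ, EuclideanSpace ℂ (Fin (2 * n - 1)))) 𝓘(ℝ, ℂ) ∞
      (fun q : EuclideanSpace ℂ (Fin n) × CProj (2 * n - 1) => projPhi n q.1 q.2) := by
  have hs : ∀ k : Fin n, ContMDiff 𝓘(ℝ, EuclideanSpace ℂ (Fin (2 * n - 1))) 𝓘(ℝ, ℂ) ∞
      (fun p => projPhi n (EuclideanSpace.single k 1) p) := fun k =>
    CProj.contMDiff_of_contDiff_lift (projPhi_mk _) fun l => CProj.contDiff_rayleigh_lift l
  have h : ∀ q : EuclideanSpace ℂ (Fin n) × CProj (2 * n - 1), projPhi n q.1 q.2 =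
      ∑ k, q.1 k * projPhi n (EuclideanSpace.single k 1) q.2 := by
    rintro ⟨a, p⟩
    induction p using Projectivization.ind with
    | h z hz =>
      simp only [projPhi_mk, CProj.rayleigh, inner_phiOperator, ← mul_div_assoc]
      rw [← Finset.sum_div]
      congr 1
      refine Finset.sum_congr rfl fun k _ => ?_
      simp [mul_assoc]
  simp only [h]
  refine contMDiff_finsetSum fun k _ => ?_
  have h1 : ContMDiff (𝓘(ℝ, EuclideanSpace ℂ (Fin n)).prod
      𝓘(ℝ, EuclideanSpace ℂ (Fin (2 * n - 1)))) 𝓘(ℝ, ℂ) ∞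
      (fun q : EuclideanSpace ℂ (Fin n) × CProj (2 * n - 1) => q.1 k) :=
    ((EuclideanSpace.proj k : EuclideanSpace ℂ (Fin n) →L[ℂ] ℂ).restrictScalars
      ℝ).contMDiff.comp contMDiff_fst
  exact (contDiff_fst.mul contDiff_snd : ContDiff ℝ ∞ fun x : ℂ × ℂ => x.1 * x.2).contMDiff.comp
    (h1.prodMk_space ((hs k).comp contMDiff_snd))

/-- The zero set of `Φ_a` determines `a` up to a constant. -/
theorem preimage_projPhi_eq_iff (hn : 1 ≤ n) (ha : a ∈ paramSet n) (hb : b ∈ paramSet n) :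
    projPhi n a ⁻¹' {0} = projPhi n b ⁻¹' {0} ↔ ∃ c : ℂ, b = c • a := by
  constructor
  · intro h
    let o : Fin n := ⟨0, hn⟩
    refine ⟨b o / a o, PiLp.ext fun k => ?_⟩
    by_cases hk : k = o
    · subst hk
      simp [div_mul_cancel₀ _ (ha o)]
    -- The point has `z_o = a_k`, `z_k = -a_o` and `z_{n+o} = z_{n+k} = 1`, so the sum for a
    -- parameter `c` is `c_o a_k - c_k a_o`. It vanishes for `c = a`, and its vanishing for `c = b`
    -- is the proportionality sought.
    let z : EuclideanSpace ℂ (Fin (2 * n - 1 + 1)) :=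
      EuclideanSpace.single (fstIndex o) (a k) - EuclideanSpace.single (fstIndex k) (a o) +
        EuclideanSpace.single (sndIndex o) 1 + EuclideanSpace.single (sndIndex k) 1
    have hzo : z (fstIndex o) = a k := by
      simp [z, fstIndex_injective.eq_iff, Ne.symm hk, fstIndex_ne_sndIndex]
    have hz : z ≠ 0 := fun h0 => ha k (by rw [← hzo, h0]; rfl)
    have hsum : ∀ c : EuclideanSpace ℂ (Fin n),
        ∑ l, c l * z (fstIndex l) * (starRingEnd ℂ) (z (sndIndex l)) =
          c o * a k - c k * a o := fun c => by
      have h1 : ∀ l, z (fstIndex l) = (if l = o then a k else 0) - if l = k then a o else 0 :=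
        fun l => by
          simp [z, fstIndex_injective.eq_iff, fstIndex_ne_sndIndex]
      have h2 : ∀ l, z (sndIndex l) = (if l = o then 1 else 0) + if l = k then 1 else 0 :=
        fun l => by
          simp [z, sndIndex_injective.eq_iff, (fstIndex_ne_sndIndex _ _).symm]
      have h3 : ∀ l, c l * z (fstIndex l) * (starRingEnd ℂ) (z (sndIndex l)) =
          (if l = o then c o * a k else 0) - if l = k then c k * a o else 0 := fun l => by
        rw [h1, h2]
        by_cases h4 : l = o
        · subst h4
          simp [Ne.symm hk]
        · by_cases h5 : l = k
          · subst h5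
            simp [h4]
          · simp [h4, h5]
      simp [h3, Finset.sum_sub_distrib]
    have h1 : Projectivization.mk ℂ z hz ∈ projPhi n a ⁻¹' {0} :=
      (projPhi_eq_zero_iff a z hz).2 (by rw [hsum]; ring)
    rw [h] at h1
    have h2 := (projPhi_eq_zero_iff b z hz).1 h1
    rw [hsum] at h2
    rw [PiLp.smul_apply, smul_eq_mul, div_mul_eq_mul_div, eq_div_iff (ha o)]
    linear_combination -h2
  · rintro ⟨c, rfl⟩
    -- The statement allows `c = 0`, but then `b` would have zero coordinates.
    have hc : c ≠ 0 := fun h => hb ⟨0, hn⟩ (by simp [h])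
    ext p
    induction p using Projectivization.ind with
    | h z hz =>
      simp only [Set.mem_preimage, Set.mem_singleton_iff]
      rw [projPhi_eq_zero_iff, projPhi_eq_zero_iff]
      simp [mul_assoc, ← Finset.mul_sum, hc]


end

theorem mainTheorem3 (n : ℕ) (hn : 1 ≤ n) :
    (∀ a ∈ paramSet n,
      RiemannianGeometry.IsEigenfunction (CProj.fubiniStudy (2 * n - 1)) (projPhi n a) ∧
      (projPhi n a ⁻¹' {0}).Nonempty ∧
      (∀ p ∈ projPhi n a ⁻¹' {0},
        RiemannianGeometry.complexGradient (CProj.fubiniStudy (2 * n - 1)) (projPhi n a) p ≠ 0) ∧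
      RiemannianGeometry.IsMinimalSubmanifold (CProj.fubiniStudy (2 * n - 1))
        (projPhi n a ⁻¹' {0}) 2) ∧
    (IsOpen (paramSet n) ∧ (paramSet n).Nonempty ∧
      (∀ p, Differentiable ℂ fun a => projPhi n a p) ∧
      ContMDiff (𝓘(ℝ, EuclideanSpace ℂ (Fin n)).prod
          𝓘(ℝ, EuclideanSpace ℂ (Fin (2 * n - 1)))) 𝓘(ℝ, ℂ) ∞
        (fun q : EuclideanSpace ℂ (Fin n) × CProj (2 * n - 1) => projPhi n q.1 q.2) ∧
      ∀ a ∈ paramSet n, ∀ b ∈ paramSet n,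
        projPhi n a ⁻¹' {0} = projPhi n b ⁻¹' {0} ↔ ∃ c : ℂ, b = c • a) := by
  refine ⟨fun a ha => ?_, isOpen_paramSet n, paramSet_nonempty n, differentiable_projPhi,
    contMDiff_projPhi n, fun a ha b hb => preimage_projPhi_eq_iff hn ha hb⟩
  have heig := CProj.isEigenfunction_of_sq_eq_zero (projPhi_mk a) phiOperator_phiOperator
    (matrixTrace_phiOperator hn)
  have hgrad : ∀ p ∈ projPhi n a ⁻¹' {0},
      RiemannianGeometry.complexGradient (CProj.fubiniStudy (2 * n - 1)) (projPhi n a) p ≠ 0 := fun p hp =>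
    complexGradient_projPhi_ne_zero hn ha hp
  -- The fibre has dimension `2(2n-1) - 2 = 4n - 4`; for `n ≥ 1` the truncated subtractions are
  -- genuine.
  refine ⟨heig, preimage_projPhi_nonempty hn a, hgrad,
    heig.isMinimalSubmanifold _ hgrad (k := 4 * n - 4) ?_⟩
  rw [finrank_real_of_complex, finrank_euclideanSpace_fin]
  omega
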